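/- Let $X$ be a complex manifold, $\mathcal O$, $\mathcal O^\times$, $\Omega^1$ its sheaves of analytic functions, invertible analytic functions and analytic $1$-forms, $\mathbb Z(1)=\mathbb Z\cdot 2\pi i$, all tensor products being over $\mathbb Z$, and $\mathcal O(1)=\mathcal O\otimes\mathbb Z(1)$. Consider the complexes of sheaves (in degrees $0,1$) $\mathcal O\otimes\mathcal O\to\Omega^1$, $a\otimes b\mapsto b\,da$, and $\mathcal O(1)\to\Omega^1$, its restriction along $\mathcal O(1)\to\mathcal O\otimes\mathcal O$. (1) With $\mathcal O\otimes\mathcal O\to\mathcal O\otimes\mathcal O^\times$, $a\otimes b\mapsto a\otimes e^{b}$, the sequence of complexes $$0\to(\mathcal O(1)\to\Omega^1)\to(\mathcal O\otimes\mathcal O\to\Omega^1)\to\mathcal O\otimes\mathcal O^\times[0]\to0$$ is exact, and its connecting map $\partial:H^0(X,\mathcal O\otimes\mathcal O^\times)\to\mathbb H^1(X,\mathcal O(1)\to\Omega^1)$ factors as $$H^0(X,\mathcal O\otimes\mathcal O^\times)\xrightarrow{\ a\otimes f\,\mapsto\, a\,df/f\ }H^0(X,\Omega^1)\xrightarrow{\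 -\iota\ }\mathbb H^1(X,\mathcal O(1)\to\Omega^1),$$ where $\iota$ is induced by the inclusion of $\Omega^1$, placed in degree $1$, into $\mathcal O(1)\to\Omega^1$. (2) Let $a\in\mathcal O(X)$ be such that $a$ and $1-a$ are units, and let $\epsilon(a)=a\otimes a+(1-a)\otimes(1-a)\in H^0(X,\mathcal O\otimes\mathcal O^\times)$. For analytic branches $u$ of $\log a$ and $v$ of $\log(1-a)$ on an open set $U\subseteq X$ put $E_{u,v}=a\,u+(1-a)\,v$. There is a unique $s\in H^0(X,\mathcal O\otimes\mathcal O)$ such that, for all such $U,u,v$, $$s|_U=a\otimes u+(1-a)\otimes v-\tfrac1{2\pi i}E_{u,v}\otimes 2\pi i ,$$ and $s$ maps to $\epsilon(a)$ in $H^0(X,\mathcal O\otimes\mathcal O^\times)$. Here $E_{u,v}$ is the branch of the entropy integral $\int^a\log\frac{t}{1-t}\,dt$ that belongs to $u,v$: one has $dE_{u,v}=(u-v)\,da$, and for the principal branches, for $z\in\mathbb C\setminus\big((-\infty,0]\cup[1,\infty)\big)$, the integral along the segment from $0$ to $z$ converges and $$\int_0^z\log\frac{t}{1-t}\,dt=z\log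 z+(1-z)\log(1-z).$$ -/

import Mathlib

open CategoryTheory TopologicalSpace Opposite
open scoped Manifold ContDiff TensorProduct

noncomputable section

universe u

namespace AdditiveRegulator

/-- The model space `ℂⁿ` of an `n`-dimensional complex manifold. -/
abbrev Model (n : ℕ) : Type := EuclideanSpace ℂ (Fin n)

section Geometry

variable (n : ℕ) (X : Type u) [TopologicalSpace X] [ChartedSpace (Model n) X]

/-- The ring `𝒪(U)` of analytic functions on the open set `U` of `X`. -/
abbrev Hol (U : Opens X) : Type u :=
  ContMDiffMap 𝓘(ℂ, Model n) 𝓘(ℂ, ℂ) U ℂ ω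

variable {n X}

/-- Restriction of analytic functions to a smaller open set. -/
abbrev Hol.res {U V : Opens X} (h : U ≤ V) : Hol n X V →+* Hol n X U :=
  ContMDiffMap.restrictRingHom 𝓘(ℂ, Model n) 𝓘(ℂ, ℂ) ℂ h

/-- A complex number, as a constant function on `U`. -/
def Hol.const (U : Opens X) (c : ℂ) : Hol n X U :=
  ⟨fun _ => c, contMDiff_const⟩

/-- The exponential of an analytic function. -/
def Hol.exp {U : Opens X} (f : Hol n X U) : Hol n X U :=
  ⟨fun x => Complex.exp (f x), Complex.contDiff_exp.contMDiff.comp f.contMDiff⟩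

/-- The exponential of an analytic function, as an invertible analytic function. -/
def Hol.expUnit {U : Opens X} (f : Hol n X U) : (Hol n X U)ˣ where
  val := f.exp
  inv := (-f).exp
  val_inv := by
    ext x
    exact (Complex.exp_add (f x) (-f x)).symm.trans (by simp)
  inv_val := by
    ext x
    exact (Complex.exp_add (-f x) (f x)).symm.trans (by simp)

lemma Hol.expUnit_add {U : Opens X} (f g : Hol n X U) :
    (f + g).expUnit = f.expUnit * g.expUnit :=
  Units.ext (DFunLike.ext _ _ fun x => Complex.exp_add (f x) (g x))

lemma Hol.const_add (U : Opens X) (c d : ℂ) :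
    Hol.const (n := n) U (c + d) = Hol.const U c + Hol.const U d :=
  rfl

/-- The extension by zero of a function on `U` to `X`. -/
def extendZero {U : Opens X} (f : U → ℂ) : X → ℂ :=
  Function.extend (fun x : U => (x : X)) f 0

lemma extendZero_apply {U : Opens X} (f : U → ℂ) (x : U) : extendZero f x = f x :=
  Subtype.val_injective.extend_apply f 0 x

lemma Hol.contMDiffAt_extendZero {U : Opens X} (f : Hol n X U) (x : U) :
    ContMDiffAt 𝓘(ℂ, Model n) 𝓘(ℂ, ℂ) ω (extendZero f) (x : X) := by
  refine contMDiffAt_subtype_iff.1 ?_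
  simp only [extendZero_apply]
  exact f.contMDiff x

lemma extendZero_eventuallyEq {U V : Opens X} (f : U → ℂ) (g : V → ℂ) (x : X) (hU : x ∈ U)
    (hV : x ∈ V) (h : ∀ y (hy : y ∈ U) (hy' : y ∈ V), f ⟨y, hy⟩ = g ⟨y, hy'⟩) :
    extendZero f =ᶠ[nhds x] extendZero g := by
  filter_upwards [U.isOpen.mem_nhds hU, V.isOpen.mem_nhds hV] with y hy hy'
  exact ((extendZero_apply f ⟨y, hy⟩).trans (h y hy hy')).trans (extendZero_apply g ⟨y, hy'⟩).symm

variable (n X)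

/-- The presheaf `U ↦ 𝒪(U)` (additive group). -/
def O : (Opens X)ᵒᵖ ⥤ AddCommGrpCat.{u} where
  obj U := AddCommGrpCat.of (Hol n X U.unop)
  map i := AddCommGrpCat.ofHom (Hol.res (leOfHom i.unop)).toAddMonoidHom
  map_id _ := rfl
  map_comp _ _ := rfl

/-- The presheaf `U ↦ 𝒪(U)ˣ` (multiplicative group, written additively). -/
def Ounits : (Opens X)ᵒᵖ ⥤ AddCommGrpCat.{u} where
  obj U := AddCommGrpCat.of (Additive (Hol n X U.unop)ˣ)
  map i := AddCommGrpCat.ofHom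
    (Units.map (Hol.res (leOfHom i.unop)).toMonoidHom).toAdditive
  map_id _ := rfl
  map_comp _ _ := ConcreteCategory.hom_ext _ _ fun _ => Additive.toMul.injective (Units.ext rfl)

variable [IsManifold 𝓘(ℂ, Model n) ω X]

variable {n X} in
/-- A covector field on `U` is a holomorphic `1`-form if it is analytic as a map to the total
space of the holomorphic cotangent bundle of `X`. -/
def IsHolForm {U : Opens X}
    (w : ∀ x : U, TangentSpace 𝓘(ℂ, Model n) (x : X) →L[ℂ] ℂ) : Prop :=
  ContMDiff 𝓘(ℂ, Model n) (𝓘(ℂ, Model n).prod 𝓘(ℂ, Model n →L[ℂ] ℂ)) ω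
    (fun x : U => (Bundle.TotalSpace.mk' (Model n →L[ℂ] ℂ)
      (E := fun y : X => TangentSpace 𝓘(ℂ, Model n) y →L[ℂ] Bundle.Trivial X ℂ y) (x : X) (w x)))

variable {n X} in
lemma isHolForm_iff {U : Opens X}
    (w : ∀ x : U, TangentSpace 𝓘(ℂ, Model n) (x : X) →L[ℂ] ℂ) :
    IsHolForm w ↔ ∀ x₀ : U, ContMDiffAt 𝓘(ℂ, Model n) 𝓘(ℂ, Model n →L[ℂ] ℂ) ω
      (fun x : U => ContinuousLinearMap.inCoordinates (Model n)
        (TangentSpace 𝓘(ℂ, Model n) (M := X)) ℂ (Bundle.Trivial X ℂ)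
        (x₀ : X) (x : X) (x₀ : X) (x : X) (w x)) x₀ := by
  unfold IsHolForm ContMDiff
  refine forall_congr' fun x₀ => ?_
  rw [contMDiffAt_hom_bundle]
  exact and_iff_right contMDiff_subtype_val.contMDiffAt

/-- The group of all (not necessarily analytic) covector fields on `U`. -/
abbrev Covec (n : ℕ) {X : Type u} [TopologicalSpace X] [ChartedSpace (Model n) X]
    (U : Opens X) : Type u :=
  ∀ x : U, TangentSpace 𝓘(ℂ, Model n) (x : X) →L[ℂ] ℂ

/-- The group of holomorphic `1`-forms on the open set `U` of `X`. -/
def Forms (U : Opens X) : AddSubgroup (Covec n U) where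
  carrier := {w | IsHolForm w}
  zero_mem' := by
    refine (isHolForm_iff _).2 fun x₀ => ?_
    simp only [ContinuousLinearMap.inCoordinates, Pi.zero_apply,
      ContinuousLinearMap.zero_comp, ContinuousLinearMap.comp_zero]
    exact contMDiffAt_const
  add_mem' {v w} hv hw := by
    refine (isHolForm_iff _).2 fun x₀ => ?_
    have h := ((isHolForm_iff _).1 hv x₀).add ((isHolForm_iff _).1 hw x₀)
    refine h.congr_of_eventuallyEq (Filter.Eventually.of_forall fun x => ?_)
    simp only [ContinuousLinearMap.inCoordinates, Pi.add_apply,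
      ContinuousLinearMap.add_comp, ContinuousLinearMap.comp_add]
  neg_mem' {v} hv := by
    refine (isHolForm_iff _).2 fun x₀ => ?_
    have h := ((isHolForm_iff _).1 hv x₀).neg
    refine h.congr_of_eventuallyEq (Filter.Eventually.of_forall fun x => ?_)
    simp only [ContinuousLinearMap.inCoordinates, Pi.neg_apply,
      ContinuousLinearMap.neg_comp, ContinuousLinearMap.comp_neg]

variable {n X}

/-- The product `f ω` of an analytic function and a holomorphic `1`-form. -/
def Forms.smul {U : Opens X} (f : Hol n X U) (w : Forms n X U) : Forms n X U :=
  ⟨fun x => f x • w.1 x, by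
    refine (isHolForm_iff _).2 fun x₀ => ?_
    have h := (f.contMDiff x₀).smul ((isHolForm_iff _).1 w.2 x₀)
    refine h.congr_of_eventuallyEq (Filter.Eventually.of_forall fun x => ?_)
    simp only [ContinuousLinearMap.inCoordinates, Pi.smul_apply',
      ContinuousLinearMap.smul_comp, ContinuousLinearMap.comp_smul]⟩

/-- The differential `df` of an analytic function `f` on `U`: at a point `x` of the open set `U`
it is the derivative at `x` of `f` (extended by zero to `X`). -/
def Hol.d {U : Opens X} (f : Hol n X U) : Forms n X U :=
  ⟨fun x => mfderiv 𝓘(ℂ, Model n) 𝓘(ℂ, ℂ) (extendZero f) (x : X), by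
    refine (isHolForm_iff _).2 fun x₀ => ?_
    have h := (f.contMDiffAt_extendZero x₀).mfderiv_const (m := ω) le_top
    have h' := h.comp x₀ (contMDiff_subtype_val (n := ω)).contMDiffAt
    refine h'.congr_of_eventuallyEq (Filter.Eventually.of_forall fun x => ?_)
    ext v
    simp [inTangentCoordinates, ContinuousLinearMap.inCoordinates]
    rfl⟩

lemma Hol.d_eq {U : Opens X} (f : Hol n X U) (x : U) (L : TangentSpace 𝓘(ℂ, Model n) (x : X) →L[ℂ] ℂ)
    (h : HasMFDerivAt 𝓘(ℂ, Model n) 𝓘(ℂ, ℂ) (extendZero f) (x : X) L) : f.d.1 x = L :=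
  h.mfderiv

lemma Hol.hasMFDerivAt {U : Opens X} (f : Hol n X U) (x : U) :
    HasMFDerivAt 𝓘(ℂ, Model n) 𝓘(ℂ, ℂ) (extendZero f) (x : X) (f.d.1 x) :=
  ((f.contMDiffAt_extendZero x).mdifferentiableAt (by simp)).hasMFDerivAt

lemma Hol.d_add {U : Opens X} (f g : Hol n X U) : (f + g).d = f.d + g.d := by
  refine Subtype.ext (funext fun x => Hol.d_eq _ x _ ?_)
  refine ((f.hasMFDerivAt x).add (g.hasMFDerivAt x)).congr_of_eventuallyEq ?_
  filter_upwards [U.isOpen.mem_nhds x.2] with y hy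
  exact (extendZero_apply _ ⟨y, hy⟩).trans (congrArg₂ (· + ·)
    (extendZero_apply _ ⟨y, hy⟩).symm (extendZero_apply _ ⟨y, hy⟩).symm)

lemma Hol.d_mul {U : Opens X} (f g : Hol n X U) :
    (f * g).d = Forms.smul f g.d + Forms.smul g f.d := by
  refine Subtype.ext (funext fun x => Hol.d_eq _ x _ ?_)
  have h := (f.hasMFDerivAt x).mul (g.hasMFDerivAt x)
  rw [extendZero_apply, extendZero_apply] at h
  refine h.congr_of_eventuallyEq ?_
  filter_upwards [U.isOpen.mem_nhds x.2] with y hy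
  exact (extendZero_apply _ ⟨y, hy⟩).trans (congrArg₂ (· * ·)
    (extendZero_apply _ ⟨y, hy⟩).symm (extendZero_apply _ ⟨y, hy⟩).symm)

/-- Restriction of holomorphic `1`-forms to a smaller open set. -/
def Forms.res {U V : Opens X} (h : U ≤ V) : Forms n X V →+ Forms n X U where
  toFun w := ⟨fun x => w.1 (Set.inclusion h x), w.2.comp (contMDiff_inclusion h)⟩
  map_zero' := rfl
  map_add' _ _ := rfl

lemma Hol.d_res {U V : Opens X} (h : U ≤ V) (f : Hol n X V) :
    (Hol.res h f).d = Forms.res h f.d := by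
  refine Subtype.ext (funext fun x => Hol.d_eq _ x _ ?_)
  refine (f.hasMFDerivAt (Set.inclusion h x)).congr_of_eventuallyEq ?_
  exact extendZero_eventuallyEq _ _ _ x.2 (h x.2) fun y hy hy' => rfl

variable (n X)

/-- The presheaf `U ↦ Ω¹(U)`. -/
def FormsPresheaf : (Opens X)ᵒᵖ ⥤ AddCommGrpCat.{u} where
  obj U := AddCommGrpCat.of (Forms n X U.unop)
  map i := AddCommGrpCat.ofHom (Forms.res (leOfHom i.unop))
  map_id _ := rfl
  map_comp _ _ := rfl

open Classical in
lemma isSheaf_forms :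
    Presheaf.IsSheaf (Opens.grothendieckTopology X) (FormsPresheaf n X) := by
  refine (TopCat.Presheaf.isSheaf_iff_isSheafUniqueGluing (X := TopCat.of X)
    (FormsPresheaf n X)).2 ?_
  intro ι U sf hsf
  have key : ∀ (i j : ι) (x : X) (hi : x ∈ U i) (hj : x ∈ U j),
      (sf i).1 ⟨x, hi⟩ = (sf j).1 ⟨x, hj⟩ := fun i j x hi hj =>
    congrFun (congrArg Subtype.val (hsf i j)) ⟨x, hi, hj⟩
  have hmem : ∀ x : (iSup U : Opens X), ∃ i, (x : X) ∈ U i := fun x =>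
    Opens.mem_iSup.1 x.2
  choose c hc using hmem
  let s : Covec n (iSup U : Opens X) := fun x => (sf (c x)).1 ⟨x, hc x⟩
  have hs : IsHolForm s := by
    refine (isHolForm_iff _).2 fun x₀ => ?_
    have h := (isHolForm_iff _).1 (sf (c x₀)).2 ⟨x₀, hc x₀⟩
    have h₂ : ContMDiffAt 𝓘(ℂ, Model n) 𝓘(ℂ, Model n →L[ℂ] ℂ) ω
      (fun x : X => ContinuousLinearMap.inCoordinates (Model n)
        (TangentSpace 𝓘(ℂ, Model n) (M := X)) ℂ (Bundle.Trivial X ℂ)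
        (x₀ : X) (x : X) (x₀ : X) (x : X)
        (if hx : x ∈ U (c x₀) then (sf (c x₀)).1 ⟨x, hx⟩ else 0)) x₀ := by
      refine (contMDiffAt_subtype_iff (U := U (c x₀)) (x := ⟨x₀, hc x₀⟩)).1 ?_
      refine h.congr_of_eventuallyEq (Filter.Eventually.of_forall fun x => ?_)
      simp only [dif_pos x.2]
    have h₃ := h₂.comp x₀ (contMDiff_subtype_val (n := ω)).contMDiffAt
    refine h₃.congr_of_eventuallyEq ?_
    filter_upwards [continuous_subtype_val.continuousAt.preimage_mem_nhds
      ((U (c x₀)).isOpen.mem_nhds (hc x₀))] with x hx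
    have hx' : (x : X) ∈ U (c x₀) := hx
    simp only [Function.comp, dif_pos hx', s]
    rw [key (c x) (c x₀) x (hc x) hx']
  refine ⟨⟨s, hs⟩, fun i => ?_, fun t ht => ?_⟩
  · refine Subtype.ext (funext fun x => ?_)
    exact key _ _ _ _ _
  · refine Subtype.ext (funext fun x => ?_)
    exact congrFun (congrArg Subtype.val (ht (c x))) ⟨x, hc x⟩

/-- The sheaf `Ω¹` of holomorphic `1`-forms on `X`. -/
def Ω : Sheaf (Opens.grothendieckTopology X) AddCommGrpCat.{u} :=
  ⟨FormsPresheaf n X, isSheaf_forms n X⟩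

variable {n X} in
lemma Forms.smul_add {U : Opens X} (f : Hol n X U) (v w : Forms n X U) :
    Forms.smul f (v + w) = Forms.smul f v + Forms.smul f w :=
  Subtype.ext (funext fun x => _root_.smul_add (f x) (v.1 x) (w.1 x))

variable {n X} in
lemma Forms.add_smul {U : Opens X} (f g : Hol n X U) (w : Forms n X U) :
    Forms.smul (f + g) w = Forms.smul f w + Forms.smul g w :=
  Subtype.ext (funext fun x => _root_.add_smul (f x) (g x) (w.1 x))

variable {n X} in
lemma Forms.mul_smul {U : Opens X} (f g : Hol n X U) (w : Forms n X U) :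
    Forms.smul (f * g) w = Forms.smul f (Forms.smul g w) :=
  Subtype.ext (funext fun x => SemigroupAction.mul_smul (f x) (g x) (w.1 x))

variable {n X} in
/-- The logarithmic differential `df / f` of an invertible analytic function. -/
def Hol.dlog {U : Opens X} (f : (Hol n X U)ˣ) : Forms n X U :=
  Forms.smul (f⁻¹ : (Hol n X U)ˣ).val f.val.d

variable {n X} in
lemma Hol.dlog_mul {U : Opens X} (f g : (Hol n X U)ˣ) :
    Hol.dlog (f * g) = Hol.dlog f + Hol.dlog g := by
  unfold Hol.dlog
  rw [Units.val_mul, Hol.d_mul, Forms.smul_add, ← Forms.mul_smul, ← Forms.mul_smul, add_comm]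
  congr 2
  · rw [mul_inv_rev, Units.val_mul, mul_right_comm, Units.inv_mul, one_mul]
  · rw [mul_inv_rev, Units.val_mul, mul_assoc, mul_comm _ f.val, Units.mul_inv, mul_one]

variable {n X} in
lemma Hol.dlog_res {U V : Opens X} (h : U ≤ V) (f : (Hol n X V)ˣ) :
    Hol.dlog (Units.map (Hol.res h).toMonoidHom f) = Forms.res h (Hol.dlog f) := by
  have h' := Hol.d_res h f.val
  unfold Hol.dlog
  exact congrArg (Forms.smul _) h'

end Geometry

section Tensor

universe v

variable {X : Type u} [TopologicalSpace X]

/-- The presheaf `U ↦ F(U) ⊗_ℤ G(U)`. -/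
def tensorPresheaf (F : (Opens X)ᵒᵖ ⥤ AddCommGrpCat.{u}) (G : (Opens X)ᵒᵖ ⥤ AddCommGrpCat.{v}) :
    (Opens X)ᵒᵖ ⥤ AddCommGrpCat.{max u v} where
  obj U := AddCommGrpCat.of (F.obj U ⊗[ℤ] G.obj U)
  map i := AddCommGrpCat.ofHom (TensorProduct.map (F.map i).hom.toIntLinearMap
    (G.map i).hom.toIntLinearMap).toAddMonoidHom
  map_id U := by
    ext x
    induction x using TensorProduct.induction_on with
    | zero => simp
    | tmul a b => simp
    | add a b ha hb => rw [map_add, ha, hb, map_add]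
  map_comp i j := by
    ext x
    induction x using TensorProduct.induction_on with
    | zero => simp
    | tmul a b => simp
    | add a b ha hb => rw [map_add, ha, hb, map_add]

/-- The morphism of presheaves `F ⊗ G ⟶ P` that is given by a compatible family of biadditive maps
`F(U) × G(U) → P(U)`. -/
def tensorLift {F : (Opens X)ᵒᵖ ⥤ AddCommGrpCat.{u}} {G : (Opens X)ᵒᵖ ⥤ AddCommGrpCat.{v}}
    {P : (Opens X)ᵒᵖ ⥤ AddCommGrpCat.{max u v}}
    (β : ∀ U, F.obj U →+ G.obj U →+ P.obj U)
    (hβ : ∀ {U V} (i : U ⟶ V) (a : F.obj U) (b : G.obj U),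
      β V (F.map i a) (G.map i b) = P.map i (β U a b)) :
    tensorPresheaf F G ⟶ P where
  app U := AddCommGrpCat.ofHom (TensorProduct.liftAddHom (β U) (by simp))
  naturality U V i := by
    refine ConcreteCategory.hom_ext _ _ fun x => ?_
    change F.obj U ⊗[ℤ] G.obj U at x
    induction x using TensorProduct.induction_on with
    | zero => exact (map_zero _).trans (map_zero _).symm
    | tmul a b => exact hβ i a b
    | add a b ha hb =>
      exact (map_add _ _ _).trans ((congrArg₂ (· + ·) ha hb).trans (map_add _ _ _).symm)

/-- The sheaf associated with a presheaf of abelian groups on `X`. -/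
abbrev assocSheaf (F : (Opens X)ᵒᵖ ⥤ AddCommGrpCat.{u}) :
    Sheaf (Opens.grothendieckTopology X) AddCommGrpCat.{u} :=
  (presheafToSheaf (Opens.grothendieckTopology X) AddCommGrpCat.{u}).obj F

/-- The morphism from an associated sheaf to a sheaf that corresponds to a morphism of presheaves.
-/
abbrev sheafLift {F : (Opens X)ᵒᵖ ⥤ AddCommGrpCat.{u}}
    {G : Sheaf (Opens.grothendieckTopology X) AddCommGrpCat.{u}} (φ : F ⟶ G.obj) :
    assocSheaf F ⟶ G :=
  ((sheafificationAdjunction (Opens.grothendieckTopology X) AddCommGrpCat.{u}).homEquiv F G).symm φ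

/-- The section over `U` of the sheaf `F ⊗ G` defined by an element of `F(U) ⊗_ℤ G(U)`. -/
def toSection {F : (Opens X)ᵒᵖ ⥤ AddCommGrpCat.{u}} (U : Opens X) (x : F.obj (op U)) :
   (assocSheaf F).obj.obj (op U) :=
  (toSheafify (Opens.grothendieckTopology X) F).app (op U) x

end Tensor

section Maps

variable (n : ℕ) (X : Type u) [TopologicalSpace X] [ChartedSpace (Model n) X]

/-- The group `ℤ(1) = ℤ · 2πi`. -/
abbrev Z1 : AddSubgroup ℂ := AddSubgroup.zmultiples (2 * Real.pi * Complex.I)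

/-- The sheaf `𝒪(1) = 𝒪 ⊗_ℤ ℤ(1)`. -/
def O1 : Sheaf (Opens.grothendieckTopology X) AddCommGrpCat.{u} :=
  assocSheaf (tensorPresheaf (O n X) ((Functor.const _).obj (AddCommGrpCat.of Z1)))

/-- The sheaf `𝒪 ⊗_ℤ 𝒪`. -/
def OO : Sheaf (Opens.grothendieckTopology X) AddCommGrpCat.{u} :=
  assocSheaf (tensorPresheaf (O n X) (O n X))

/-- The sheaf `𝒪 ⊗_ℤ 𝒪ˣ`. -/
def OOx : Sheaf (Opens.grothendieckTopology X) AddCommGrpCat.{u} :=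
  assocSheaf (tensorPresheaf (O n X) (Ounits n X))

variable {n X} in
/-- The biadditive map `(a, z) ↦ a ⊗ z`. -/
def inclBi (U : Opens X) : Hol n X U →+ Z1 →+ Hol n X U ⊗[ℤ] Hol n X U :=
  AddMonoidHom.mk' (fun a => AddMonoidHom.mk' (fun z => a ⊗ₜ[ℤ] Hol.const U (z : ℂ))
    (fun z w => by rw [AddSubgroup.coe_add, Hol.const_add, TensorProduct.tmul_add]))
    (fun a b => by ext z : 1; exact TensorProduct.add_tmul _ _ _)

variable {n X} in
/-- The biadditive map `(a, b) ↦ a ⊗ exp b`. -/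
def expBi (U : Opens X) :
    Hol n X U →+ Hol n X U →+ Hol n X U ⊗[ℤ] Additive (Hol n X U)ˣ :=
  AddMonoidHom.mk' (fun a => AddMonoidHom.mk' (fun b => a ⊗ₜ[ℤ] Additive.ofMul b.expUnit)
    (fun b c => by rw [Hol.expUnit_add, ofMul_mul, TensorProduct.tmul_add]))
    (fun a b => by ext z : 1; exact TensorProduct.add_tmul _ _ _)

/-- The map of presheaves that underlies `𝒪(1) → 𝒪 ⊗ 𝒪`. -/
def inclPre : tensorPresheaf (O n X) ((Functor.const _).obj (AddCommGrpCat.of Z1)) ⟶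
    tensorPresheaf (O n X) (O n X) :=
  tensorLift (P := tensorPresheaf (O n X) (O n X)) (fun U => inclBi U.unop) (fun _ _ _ => rfl)

/-- The map of presheaves that underlies `𝒪 ⊗ 𝒪 → 𝒪 ⊗ 𝒪ˣ`. -/
def expPre : tensorPresheaf (O n X) (O n X) ⟶ tensorPresheaf (O n X) (Ounits n X) :=
  tensorLift (P := tensorPresheaf (O n X) (Ounits n X)) (fun U => expBi U.unop)
    (fun _ _ _ => congrArg (fun t => _ ⊗ₜ[ℤ] t) (Additive.toMul.injective (Units.ext rfl)))

/-- The map `𝒪(1) → 𝒪 ⊗ 𝒪`, `a ⊗ z ↦ a ⊗ z`. -/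
def incl : O1 n X ⟶ OO n X := (presheafToSheaf _ _).map (inclPre n X)

/-- The map `𝒪 ⊗ 𝒪 → 𝒪 ⊗ 𝒪ˣ`, `a ⊗ b ↦ a ⊗ exp b`. -/
def expMap : OO n X ⟶ OOx n X := (presheafToSheaf _ _).map (expPre n X)

lemma exp_Z1 (U : Opens X) (z : Z1) : (Hol.const (n := n) U (z : ℂ)).expUnit = 1 := by
  obtain ⟨k, hk⟩ := AddSubgroup.mem_zmultiples_iff.1 z.2
  refine Units.ext (DFunLike.ext _ _ fun x => ?_)
  change Complex.exp (z : ℂ) = 1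
  rw [← hk, zsmul_eq_mul]
  exact Complex.exp_int_mul_two_pi_mul_I k

lemma inclPre_exp : inclPre n X ≫ expPre n X = 0 := by
  refine NatTrans.ext (funext fun U => ConcreteCategory.hom_ext _ _ fun x => ?_)
  change Hol n X U.unop ⊗[ℤ] Z1 at x
  induction x using TensorProduct.induction_on with
  | zero => exact (map_zero _).trans (map_zero _).symm
  | tmul a z =>
    change a ⊗ₜ[ℤ] Additive.ofMul (Hol.const (n := n) U.unop (z : ℂ)).expUnit = 0
    rw [exp_Z1, ofMul_one, TensorProduct.tmul_zero]
  | add a b ha hb =>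
    exact (map_add _ _ _).trans ((congrArg₂ (· + ·) ha hb).trans (map_add _ _ _).symm)

lemma incl_exp : incl n X ≫ expMap n X = 0 :=
  ((presheafToSheaf _ _).map_comp _ _).symm.trans
    ((congrArg _ (inclPre_exp n X)).trans ((presheafToSheaf _ _).map_zero _ _))

variable [IsManifold 𝓘(ℂ, Model n) ω X]

variable {n X} in
/-- The biadditive map `(a, b) ↦ b da`. -/
def connBi (U : Opens X) : Hol n X U →+ Hol n X U →+ Forms n X U :=
  AddMonoidHom.mk' (fun a => AddMonoidHom.mk' (fun b => Forms.smul b a.d)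
    (fun b c => Forms.add_smul b c a.d))
    (fun a b => by
      ext c : 1
      exact (congrArg _ (Hol.d_add a b)).trans (Forms.smul_add _ _ _))

variable {n X} in
/-- The biadditive map `(a, f) ↦ a df / f`. -/
def dlogBi (U : Opens X) : Hol n X U →+ Additive (Hol n X U)ˣ →+ Forms n X U :=
  AddMonoidHom.mk' (fun a => AddMonoidHom.mk' (fun f => Forms.smul a (Hol.dlog f.toMul))
    (fun f g => (congrArg _ (Hol.dlog_mul f.toMul g.toMul)).trans (Forms.smul_add _ _ _)))
    (fun a b => AddMonoidHom.ext fun f => Forms.add_smul a b (Hol.dlog f.toMul))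

/-- The map `𝒪 ⊗ 𝒪 → Ω¹`, `a ⊗ b ↦ b da`. -/
def connMap : OO n X ⟶ Ω n X :=
  sheafLift <| tensorLift (P := FormsPresheaf n X) (fun U => connBi U.unop)
    (fun i a _ => congrArg (Forms.smul _) (Hol.d_res (leOfHom i.unop) a))

/-- The map `𝒪(1) → Ω¹`, `a ⊗ z ↦ z da`, which is the restriction of `𝒪 ⊗ 𝒪 → Ω¹`. -/
def connMap1 : O1 n X ⟶ Ω n X := incl n X ≫ connMap n X

/-- The map `𝒪 ⊗ 𝒪ˣ → Ω¹`, `a ⊗ f ↦ a df / f`. -/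
def dlogMap : OOx n X ⟶ Ω n X :=
  sheafLift <| tensorLift (P := FormsPresheaf n X) (fun U => dlogBi U.unop)
    (fun i _ f => congrArg (Forms.smul _) (Hol.dlog_res (leOfHom i.unop) f.toMul))

end Maps

section Cohomology

variable {X : Type u} [TopologicalSpace X]

/-- The category of sheaves of abelian groups on `X`. -/
abbrev Sh (X : Type u) [TopologicalSpace X] :=
  Sheaf (Opens.grothendieckTopology X) AddCommGrpCat.{u}

instance : HasDerivedCategory.{u + 1} (Sh X) := HasDerivedCategory.standard _

/-- The group `H⁰(X, F)` of global sections of a sheaf. -/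
abbrev H0 (F : Sh X) : Type u := F.obj.obj (op ⊤)

/-- The map on global sections induced by a morphism of sheaves. -/
abbrev H0.map {F G : Sh X} (φ : F ⟶ G) : H0 F →+ H0 G := (φ.hom.app (op ⊤)).hom

/-- The constant sheaf `ℤ` on `X`. -/
def constZ (X : Type u) [TopologicalSpace X] : Sh X :=
  (constantSheaf _ AddCommGrpCat.{u}).obj (AddCommGrpCat.of (ULift ℤ))

/-- The identification of global sections of `F` with morphisms from the constant sheaf `ℤ`
to `F`. -/
def sectionHom (F : Sh X) : H0 F ≃+ (constZ X ⟶ F) :=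
  (((constantSheafAdj (Opens.grothendieckTopology X) AddCommGrpCat.{u}
    (Limits.isTerminalTop : Limits.IsTerminal (⊤ : Opens X))).homAddEquiv _ F).trans
      (AddCommGrpCat.uliftZMultiplesAddEquiv _)).symm

/-- The hypercohomology group `ℍⁱ(X, K)` of a complex of sheaves of abelian groups, i.e. the group
of morphisms `ℤ → K[i]` in the derived category of sheaves of abelian groups on `X`. -/
abbrev HyperH (K : CochainComplex (Sh X) ℤ) (i : ℤ) : Type (u + 1) :=
  DerivedCategory.Q.obj ((HomologicalComplex.single (Sh X) (ComplexShape.up ℤ) 0).obj (constZ X)) ⟶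
    (DerivedCategory.Q.obj K)⟦i⟧

/-- The two-term complex `A → B` with `A` in degree `0` and `B` in degree `1`. -/
abbrev twoTerm {A B : Sh X} (f : A ⟶ B) : CochainComplex (Sh X) ℤ :=
  HomologicalComplex.double f (c := ComplexShape.up ℤ) (i₀ := 0) (i₁ := 1) (by simp)

/-- The sheaf `F`, as a complex concentrated in degree `0`. -/
abbrev inDegZero (F : Sh X) : CochainComplex (Sh X) ℤ :=
  (HomologicalComplex.single (Sh X) (ComplexShape.up ℤ) 0).obj F

/-- The morphism of complexes `B[0] → (A → B)[1]` which is the identity of `B` in degree `0`. -/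
def toTwoTermShift {A B : Sh X} (f : A ⟶ B) :
    inDegZero B ⟶ (twoTerm f)⟦(1 : ℤ)⟧ :=
  HomologicalComplex.mkHomFromSingle
    ((HomologicalComplex.doubleXIso₁ (c := ComplexShape.up ℤ) (i₀ := 0) (i₁ := 1) f (by simp)
      (by simp)).inv ≫ ((twoTerm f).shiftFunctorObjXIso 1 0 1 (by simp)).inv)
    (fun k hk => by
      obtain rfl : 1 = k := by simpa using hk
      simp [HomologicalComplex.double_d_eq_zero₀]
      rfl)

/-- The natural map `H⁰(X, B) → ℍ¹(X, A → B)`, which is induced by the inclusion of `B`, placed in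
degree `1`, into the complex `A → B`. -/
def H0.toHyperH1 {A B : Sh X} (f : A ⟶ B) : H0 B →+ HyperH (twoTerm f) 1 :=
  AddMonoidHom.mk' (fun s =>
    DerivedCategory.Q.map ((HomologicalComplex.single (Sh X) (ComplexShape.up ℤ) 0).map
      (sectionHom B s)) ≫ DerivedCategory.Q.map (toTwoTermShift f) ≫
      ((DerivedCategory.Q (C := Sh X)).commShiftIso (1 : ℤ)).hom.app (twoTerm f))
    (fun s t => by
      simp only [map_add, Functor.map_add]
      exact Preadditive.add_comp _ _ _ _ _ _)

/-- The connecting map `H⁰(X, F) → ℍ¹(X, K)` of a short exact sequence of complexes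
`0 → K → L → F[0] → 0`. -/
def connecting {K L : CochainComplex (Sh X) ℤ} {F : Sh X} (f : K ⟶ L) (g : L ⟶ inDegZero F) (w : f ≫ g = 0)
    (h : (ShortComplex.mk f g w).ShortExact) : H0 F →+ HyperH K 1 :=
  AddMonoidHom.mk' (fun s =>
    DerivedCategory.Q.map ((HomologicalComplex.single (Sh X) (ComplexShape.up ℤ) 0).map
      (sectionHom F s)) ≫ DerivedCategory.triangleOfSESδ h)
    (fun s t => by
      simp only [map_add, Functor.map_add]
      exact Preadditive.add_comp _ _ _ _ _ _)

end Cohomology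

section Regulator

variable (n : ℕ) (X : Type u) [TopologicalSpace X] [ChartedSpace (Model n) X]
  [IsManifold 𝓘(ℂ, Model n) ω X]

/-- The morphism of complexes `(𝒪(1) → Ω¹) → (𝒪 ⊗ 𝒪 → Ω¹)`. -/
def complexIncl : twoTerm (connMap1 n X) ⟶ twoTerm (connMap n X) :=
  HomologicalComplex.mkHomFromDouble _ (by simp)
    (incl n X ≫ (HomologicalComplex.doubleXIso₀ (connMap n X) _).inv)
    (HomologicalComplex.doubleXIso₁ (connMap n X) _ (by simp)).inv
    (by simp [connMap1, HomologicalComplex.double_d])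
    (fun k _ => by simp [HomologicalComplex.double_d_eq_zero₀])

/-- The morphism of complexes `(𝒪 ⊗ 𝒪 → Ω¹) → 𝒪 ⊗ 𝒪ˣ`. -/
def complexExp : twoTerm (connMap n X) ⟶ inDegZero (OOx n X) :=
  HomologicalComplex.mkHomFromDouble _ (by simp)
    (expMap n X ≫ (HomologicalComplex.singleObjXSelf (ComplexShape.up ℤ) 0 (OOx n X)).inv)
    0
    (by simp) (by simp)

/-- The short complex of complexes `(𝒪(1) → Ω¹) → (𝒪 ⊗ 𝒪 → Ω¹) → 𝒪 ⊗ 𝒪ˣ`. -/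
def expSequence : ShortComplex (CochainComplex (Sh X) ℤ) :=
  ShortComplex.mk (complexIncl n X) (complexExp n X) (by
    apply HomologicalComplex.from_double_hom_ext
    · simp [complexIncl, complexExp, reassoc_of% (incl_exp n X)]
    · simp [complexIncl, complexExp])

variable {n X} in
/-- The map `∂ : H⁰(X, 𝒪 ⊗ 𝒪ˣ) → ℍ¹(X, 𝒪(1) → Ω¹)`, i.e. the connecting map of the exact sequence
of complexes `0 → (𝒪(1) → Ω¹) → (𝒪 ⊗ 𝒪 → Ω¹) → 𝒪 ⊗ 𝒪ˣ → 0`. -/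
def boundary (h : (expSequence n X).ShortExact) :
    H0 (OOx n X) →+ HyperH (twoTerm (connMap1 n X)) 1 :=
  connecting (complexIncl n X) (complexExp n X) _ h

end Regulator

section Entropy

variable {n : ℕ} {X : Type u} [TopologicalSpace X] [ChartedSpace (Model n) X]

/-- The element `ε(a) = a ⊗ a + (1 - a) ⊗ (1 - a)` of `H⁰(X, 𝒪 ⊗ 𝒪ˣ)`. -/
def cathelineau {a : Hol n X ⊤} (h₀ : IsUnit a) (h₁ : IsUnit (1 - a)) : H0 (OOx n X) :=
  toSection (F := tensorPresheaf (O n X) (Ounits n X)) ⊤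
    (a ⊗ₜ[ℤ] Additive.ofMul h₀.unit + (1 - a) ⊗ₜ[ℤ] Additive.ofMul h₁.unit)

/-- `(u, v)` is a pair of analytic branches on `U` of `log a` and `log (1 - a)`. -/
def IsLogPair (a : Hol n X ⊤) {U : Opens X} (u v : Hol n X U) : Prop :=
  u.exp = Hol.res le_top a ∧ v.exp = Hol.res le_top (1 - a)

/-- The branch `a log a + (1 - a) log (1 - a)` of the entropy function on `U` that belongs to the
branches `u` of `log a` and `v` of `log (1 - a)`. -/
def entropy (a : Hol n X ⊤) {U : Opens X} (u v : Hol n X U) : Hol n X U :=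
  Hol.res le_top a * u + Hol.res le_top (1 - a) * v

/-- The integral `∫₀ᶻ log (t / (1 - t)) dt` of the principal branch along the segment from `0` to
`z`. -/
def entropyIntegral (z : ℂ) : ℂ :=
  ∫ r in (0 : ℝ)..1, Complex.log (r * z / (1 - r * z)) * z

/-- The section `a ⊗ u + (1 - a) ⊗ v - (1 / 2πi) E ⊗ 2πi` of `𝒪 ⊗ 𝒪` over `U`, where `E` is the
branch of the entropy function that belongs to `u` and `v`. -/
def entropySection (a : Hol n X ⊤) {U : Opens X} (u v : Hol n X U) :
    (OO n X).obj.obj (op U) :=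
  toSection (F := tensorPresheaf (O n X) (O n X)) U
    ((Hol.res le_top a : Hol n X U) ⊗ₜ[ℤ] u + (Hol.res le_top (1 - a) : Hol n X U) ⊗ₜ[ℤ] v
      - (Hol.const U (1 / (2 * Real.pi * Complex.I)) * entropy a u v) ⊗ₜ[ℤ]
          Hol.const (n := n) U (2 * Real.pi * Complex.I))

end Entropy

end AdditiveRegulator

end

open AdditiveRegulator

noncomputable section

universe u

namespace AdditiveRegulator

/-! ### The entropy integral along a segment -/

section EntropyIntegral

open Complex

/-! Everything rests on the retraction `retr : a ⊗ b ↦ (ab / 2πi) ⊗ 2πi` of `𝒪(1) → 𝒪 ⊗ 𝒪`.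

For exactness, `𝒪(U)` is torsion-free, hence flat over `ℤ`, so tensoring with it preserves the
exactness of `ℤ(1) → 𝒪 → 𝒪ˣ` on a connected open set (`exists_inclPre_eq`). Connected open sets form
a basis of `X`, and local logarithms give surjectivity.

With the identity of `Ω¹` in degree `1`, `retr` retracts the subcomplex degree by degree. The
connecting morphism of a degreewise split sequence is the failure of the retraction to commute with
the differentials (`triangleOfSESδ_eq_of_retraction`). By the Leibniz rule `d(ab) = b da + a db`,
this failure is `-a db`, the negative of `dlog` applied to `a ⊗ exp b` (`retr_connMap1`); this is
the source of the sign.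

The section `s` is locally `x - incl (retr x)` with `x = a ⊗ u + (1 - a) ⊗ v`. Other branches change
`x` locally by an element of `𝒪(1)`, which `1 - incl ∘ retr` kills, so the local sections glue
(`entropy_tensor_eq`, `entropySection_eq`). The correction term dies in `𝒪 ⊗ 𝒪ˣ` because `exp (2πi)
= 1`.

The entropy integral is the fundamental theorem of calculus on the segment, once the principal
logarithm of `t / (1 - t)` is split as `log t - log (1 - t)` (`log_div_one_sub`). -/

/-- The sine of the sum of the arguments is `Im (pq) / (‖p‖ ‖q‖) > 0`, whereas the sine is
nonpositive on `[π, 2π]`. -/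
lemma arg_add_arg_lt_pi {p q : ℂ} (hp : 0 < p.im) (hq : 0 < q.im) (hpq : 0 < (p * q).im) :
    arg p + arg q < Real.pi := by
  have hp' : p ≠ 0 := by rintro rfl; simp at hp
  have hq' : q ≠ 0 := by rintro rfl; simp at hq
  by_contra! h
  have hsin : 0 < Real.sin (arg p + arg q) := by
    rw [Real.sin_add, sin_arg, sin_arg, cos_arg hp', cos_arg hq']
    have : p.im / ‖p‖ * (q.re / ‖q‖) + p.re / ‖p‖ * (q.im / ‖q‖) = (p * q).im / (‖p‖ * ‖q‖) := by
      rw [mul_im]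
      field_simp
      ring
    rw [this]
    have := norm_pos_iff.2 hp'
    have := norm_pos_iff.2 hq'
    positivity
  have h2 : 0 ≤ Real.sin (arg p + arg q - Real.pi) := by
    refine Real.sin_nonneg_of_nonneg_of_le_pi (by linarith) ?_
    linarith [arg_le_pi p, arg_le_pi q]
  rw [Real.sin_sub_pi] at h2
  linarith

/-- For non-real `t`, the arguments of `t` and `1 - t` have opposite signs, and their absolute
values are the angles at `0` and `1` of the triangle `0, 1, t`. These add up to less than `π`, so no
period appears. -/
lemma log_div_one_sub {t : ℂ} (h₀ : t ∈ slitPlane) (h₁ : 1 - t ∈ slitPlane) :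
    log (t / (1 - t)) = log t - log (1 - t) := by
  have hπ : arg (1 - t) ≠ Real.pi := (mem_slitPlane_iff_arg.1 h₁).1
  have hπ' : arg t ≠ Real.pi := (mem_slitPlane_iff_arg.1 h₀).1
  have hconj : ∀ z : ℂ, arg z ≠ Real.pi → arg (starRingEnd ℂ z) = -arg z := fun z hz => by
    rw [arg_conj, if_neg hz]
  rw [div_eq_mul_inv, log_mul (slitPlane_ne_zero h₀) (inv_ne_zero (slitPlane_ne_zero h₁)),
    log_inv _ hπ, ← sub_eq_add_neg]
  -- What remains is the condition for the logarithm of the product: `arg t - arg (1 - t)` lies in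
  -- `(-π, π]`.
  rw [arg_inv, if_neg hπ]
  rcases lt_trichotomy t.im 0 with h | h | h
  -- The product of `conj t` and `1 - t` is `conj t - |t|²`, with imaginary part `-Im t > 0`.
  · have := arg_add_arg_lt_pi (p := starRingEnd ℂ t) (q := 1 - t) (by simpa using h)
      (by simpa using h) (by simp [mul_im]; nlinarith)
    rw [hconj _ hπ'] at this
    have h1 : 0 ≤ arg (1 - t) := arg_nonneg_iff.2 (by simp [h.le])
    have h2 : arg t < 0 := arg_neg_iff.2 h
    constructor <;> linarith
  · have h1 : arg t = 0 := by
      rw [arg_eq_zero_iff]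
      rw [mem_slitPlane_iff] at h₀
      simp_all [le_of_lt]
    have h2 : arg (1 - t) = 0 := by
      rw [arg_eq_zero_iff]
      rw [mem_slitPlane_iff] at h₁
      simp_all [le_of_lt]
    rw [h1, h2]
    simp [Real.pi_pos, Real.pi_pos.le]
  · have := arg_add_arg_lt_pi (p := t) (q := starRingEnd ℂ (1 - t)) h
      (by simpa using h) (by simp [mul_im]; nlinarith)
    rw [hconj _ hπ] at this
    have h1 : arg (1 - t) < 0 := arg_neg_iff.2 (by simpa using h)
    have h2 : 0 ≤ arg t := arg_nonneg_iff.2 h.le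
    constructor <;> linarith

lemma one_sub_real_mul_mem_slitPlane {z : ℂ} (h₁ : 1 - z ∈ slitPlane) {r : ℝ} (h0 : 0 ≤ r)
    (h1 : r ≤ 1) : 1 - r * z ∈ slitPlane := by
  rw [mem_slitPlane_iff] at h₁ ⊢
  simp only [sub_re, one_re, sub_im, one_im, zero_sub, neg_ne_zero, mul_re, ofReal_re, ofReal_im,
    mul_im, zero_mul, sub_zero, add_zero] at h₁ ⊢
  rcases h0.eq_or_lt with rfl | h0
  · simp
  rcases h₁ with h | h
  · left
    nlinarith
  · right
    exact mul_ne_zero h0.ne' h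

lemma real_mul_mem_slitPlane {z : ℂ} (h₀ : z ∈ slitPlane) {r : ℝ} (hr : 0 < r) :
    r * z ∈ slitPlane := by
  rw [mem_slitPlane_iff] at h₀ ⊢
  simp only [mul_re, ofReal_re, ofReal_im, mul_im, zero_mul, sub_zero, add_zero]
  exact h₀.imp (fun h => mul_pos hr h) (fun h => mul_ne_zero hr.ne' h)

/-- The remaining terms of the product rule, `t / t` and `-(1 - t) / (1 - t)`, cancel. -/
lemma hasDerivAt_entropy {t : ℂ} (h₀ : t ∈ slitPlane) (h₁ : 1 - t ∈ slitPlane) :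
    HasDerivAt (fun t => t * log t + (1 - t) * log (1 - t)) (log t - log (1 - t)) t := by
  have hs : HasDerivAt (fun t : ℂ => 1 - t) (-1) t := by
    simpa using (hasDerivAt_id t).const_sub 1
  have h := ((hasDerivAt_id t).mul (hasDerivAt_log h₀)).add (hs.mul (hs.clog h₁))
  refine h.congr_deriv ?_
  have := slitPlane_ne_zero h₀
  have := slitPlane_ne_zero h₁
  simp only [id]
  field_simp
  ring

/-- Splitting off `log r` isolates the singularity at `r = 0`: it is real and integrable, and the
other terms are continuous on `[0, 1]`. -/
lemma log_integrand_eq {z : ℂ} (h₀ : z ∈ slitPlane) (h₁ : 1 - z ∈ slitPlane) {r : ℝ} (hr : 0 < r)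
    (hr' : r ≤ 1) :
    log (r * z / (1 - r * z)) * z = ((Real.log r : ℂ) + log z - log (1 - r * z)) * z := by
  rw [log_div_one_sub (real_mul_mem_slitPlane h₀ hr) (one_sub_real_mul_mem_slitPlane h₁ hr.le hr'),
    log_ofReal_mul hr (slitPlane_ne_zero h₀)]

lemma continuousOn_log_one_sub {z : ℂ} (h₁ : 1 - z ∈ slitPlane) :
    ContinuousOn (fun r : ℝ => log (1 - r * z)) (Set.Icc 0 1) :=
  ContinuousOn.clog (by fun_prop) fun _ hr => one_sub_real_mul_mem_slitPlane h₁ hr.1 hr.2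

lemma intervalIntegrable_log_integrand {z : ℂ} (h₀ : z ∈ slitPlane) (h₁ : 1 - z ∈ slitPlane) :
    IntervalIntegrable (fun r : ℝ => log (r * z / (1 - r * z)) * z) MeasureTheory.volume 0 1 := by
  have h : IntervalIntegrable
      (fun r : ℝ => ((Real.log r : ℂ) + log z - log (1 - r * z)) * z) MeasureTheory.volume 0 1 := by
    refine IntervalIntegrable.mul_const (IntervalIntegrable.sub (IntervalIntegrable.add ?_ ?_) ?_) z
    · have h := intervalIntegral.intervalIntegrable_log' (a := 0) (b := 1)
      exact ⟨h.1.ofReal, h.2.ofReal⟩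
    · exact intervalIntegrable_const
    · exact ContinuousOn.intervalIntegrable_of_Icc zero_le_one (continuousOn_log_one_sub h₁)
  refine h.congr fun r hr => ?_
  rw [Set.uIoc_of_le zero_le_one] at hr
  exact (log_integrand_eq h₀ h₁ hr.1 hr.2).symm

lemma entropyIntegral_eq {z : ℂ} (h₀ : z ∈ slitPlane) (h₁ : 1 - z ∈ slitPlane) :
    entropyIntegral z = z * log z + (1 - z) * log (1 - z) := by
  -- The antiderivative is written with the real function `r log r`, so that it is visibly
  -- continuous at `r = 0`; for `r > 0` it is the entropy function at `rz`.
  let F : ℝ → ℂ := fun r =>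
    (r * Real.log r : ℝ) * z + r * z * log z + (1 - r * z) * log (1 - r * z)
  have hF : ∀ r : ℝ, 0 < r →
      F r = r * z * log (r * z) + (1 - r * z) * log (1 - r * z) := fun r hr => by
    rw [log_ofReal_mul hr (slitPlane_ne_zero h₀)]
    simp only [F]
    push_cast
    ring
  have hcont : ContinuousOn F (Set.Icc 0 1) := by
    refine ContinuousOn.add (Continuous.continuousOn ?_) ?_
    · exact ((continuous_ofReal.comp Real.continuous_mul_log).mul continuous_const).add
        (by fun_prop)
    · exact ContinuousOn.mul (by fun_prop) (continuousOn_log_one_sub h₁)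
  have hderiv : ∀ r ∈ Set.Ioo (0 : ℝ) 1, HasDerivAt F (log (r * z / (1 - r * z)) * z) r := by
    intro r hr
    have hm := real_mul_mem_slitPlane h₀ hr.1
    have hm' := one_sub_real_mul_mem_slitPlane h₁ hr.1.le hr.2.le
    rw [log_div_one_sub hm hm']
    have hlin : HasDerivAt (fun r : ℝ => (r : ℂ) * z) z r := by
      simpa using ((hasDerivAt_id r).ofReal_comp).mul_const z
    refine ((hasDerivAt_entropy hm hm').comp r hlin).congr_of_eventuallyEq ?_
    filter_upwards [lt_mem_nhds hr.1] with x hx using hF x hx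
  have h := intervalIntegral.integral_eq_sub_of_hasDerivAt_of_le zero_le_one hcont hderiv
    (intervalIntegrable_log_integrand h₀ h₁)
  rw [entropyIntegral, h]
  simp [F]

end EntropyIntegral

/-! ### Branches of the logarithm and differentials -/

section Branches

variable {n : ℕ} {X : Type u} [TopologicalSpace X] [ChartedSpace (Model n) X]

/-- Open sets of `X` have connected open neighbourhoods of each of their points. -/
lemma exists_isPreconnected_nhd (n : ℕ) {X : Type u} [TopologicalSpace X]
    [ChartedSpace (Model n) X] (U : Opens X) {x : X} (hx : x ∈ U) :
    ∃ V : Opens X, V ≤ U ∧ x ∈ V ∧ IsPreconnected (V : Set X) := by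
  have := ChartedSpace.locallyConnectedSpace (Model n) X
  obtain ⟨V, hVU, hV, hxV, hc⟩ := locallyConnectedSpace_iff_subsets_isOpen_isConnected.1 this x U
    (U.isOpen.mem_nhds hx)
  exact ⟨⟨V, hV⟩, hVU, hxV, hc.isPreconnected⟩

/-- Distinct elements are at distance at least `2π > 1`. Discreteness makes a continuous
`ℤ(1)`-valued function on a connected set constant. -/
lemma isDiscrete_Z1 : IsDiscrete (Z1 : Set ℂ) := by
  refine ⟨discreteTopology_subtype_iff'.2 ?_⟩
  rintro _ ⟨k, rfl⟩
  refine ⟨Metric.ball (k • (2 * Real.pi * Complex.I)) 1, Metric.isOpen_ball, ?_⟩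
  ext y
  constructor
  · rintro ⟨hy, ⟨l, rfl⟩⟩
    simp only [Metric.mem_ball, dist_eq_norm, ← sub_smul] at hy
    rw [norm_smul, norm_mul, norm_mul, Complex.norm_I, Complex.norm_real, mul_one,
      Real.norm_of_nonneg Real.pi_pos.le] at hy
    have h2 : ‖(l - k : ℤ)‖ < 1 := by
      by_contra! h
      rw [Complex.norm_ofNat] at hy
      nlinarith [Real.pi_gt_three]
    rw [Int.norm_eq_abs] at h2
    have h3 : |l - k| < 1 := by exact_mod_cast h2
    have : l = k := by
      rw [Int.abs_lt_one_iff] at h3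
      omega
    simp [this]
  · rintro rfl
    exact ⟨Metric.mem_ball_self one_pos, ⟨k, rfl⟩⟩

/-- The kernel of the exponential on a connected open set is `ℤ(1)`. -/
lemma Hol.exists_eq_const {U : Opens X} (hU : IsPreconnected (U : Set X)) {f : Hol n X U}
    (hf : f.exp = 1) : ∃ z : Z1, f = Hol.const U (z : ℂ) := by
  have hU' : IsPreconnected (Set.univ : Set U) :=
    (Subtype.preconnectedSpace hU).isPreconnected_univ
  have hm : Set.MapsTo f Set.univ (Z1 : Set ℂ) := fun x _ => by
    have h : Complex.exp (f x) = 1 := DFunLike.congr_fun hf x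
    obtain ⟨k, hk⟩ := Complex.exp_eq_one_iff.1 h
    exact ⟨k, by rw [hk]; simp⟩
  -- The element `0` of `ℤ(1)` is supplied because `U` may be empty.
  obtain ⟨z, hz, h⟩ := hU'.eqOn_const_of_mapsTo isDiscrete_Z1 f.contMDiff.continuous.continuousOn
    hm ⟨0, Z1.zero_mem⟩
  exact ⟨⟨z, hz⟩, DFunLike.ext _ _ fun x => h (Set.mem_univ x)⟩

/-- An invertible analytic function has, locally, an analytic logarithm. -/
lemma Hol.exists_local_log {U : Opens X} (f : (Hol n X U)ˣ) {x : X} (hx : x ∈ U) :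
    ∃ (V : Opens X) (h : V ≤ U), x ∈ V ∧ ∃ g : Hol n X V, g.exp = Hol.res h f.val := by
  have hne : ∀ y : U, f.val y ≠ 0 := fun y h0 => by
    have h : f.val y * f.inv y = 1 := DFunLike.congr_fun f.val_inv y
    rw [h0, zero_mul] at h
    exact zero_ne_one h
  -- Dividing by the value `c` at `x` moves that value to `1`, inside the slit plane. So `log (f /
  -- c) + log c` is analytic near `x`, wherever `c` lies.
  set c := f.val ⟨x, hx⟩ with hc
  have hc0 : c ≠ 0 := hne _
  have hopen : IsOpen {y : U | f.val y / c ∈ Complex.slitPlane} :=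
    Complex.isOpen_slitPlane.preimage (f.val.contMDiff.continuous.div_const c)
  let V : Opens X := ⟨Subtype.val '' {y : U | f.val y / c ∈ Complex.slitPlane},
    U.isOpen.isOpenMap_subtype_val _ hopen⟩
  have hVU : V ≤ U := by
    rintro _ ⟨y, -, rfl⟩
    exact y.2
  have hV : ∀ y : V, Hol.res hVU f.val y / c ∈ Complex.slitPlane := by
    rintro ⟨_, y, hy, rfl⟩
    exact hy
  refine ⟨V, hVU, ⟨⟨x, hx⟩, ?_, rfl⟩, ?_⟩
  · change f.val ⟨x, hx⟩ / c ∈ Complex.slitPlane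
    rw [← hc, div_self hc0]
    exact Complex.one_mem_slitPlane
  · refine ⟨⟨fun y => Complex.log (Hol.res hVU f.val y / c) + Complex.log c, fun y => ?_⟩,
      DFunLike.ext _ _ fun y => ?_⟩
    · have h : ContDiffAt ℂ ω (fun w : ℂ => Complex.log (w / c) + Complex.log c)
          (Hol.res hVU f.val y) :=
        (ContDiffAt.comp (g := Complex.log) (f := fun w : ℂ => w / c) _
          (Complex.contDiffAt_log (hV y)) (contDiffAt_id.div_const c)).add contDiffAt_const
      exact h.contMDiffAt.comp y ((Hol.res hVU f.val).contMDiff y)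
    · change Complex.exp (Complex.log (Hol.res hVU f.val y / c) + Complex.log c) = _
      rw [Complex.exp_add, Complex.exp_log (Complex.slitPlane_ne_zero (hV y)),
        Complex.exp_log hc0, div_mul_cancel₀ _ hc0]

variable [IsManifold 𝓘(ℂ, Model n) ω X]

lemma Hol.d_exp {U : Opens X} (f : Hol n X U) : f.exp.d = Forms.smul f.exp f.d := by
  refine Subtype.ext (funext fun x => Hol.d_eq _ x _ ?_)
  have h := (Complex.hasDerivAt_exp (extendZero f (x : X))).hasFDerivAt.hasMFDerivAt.comp (x : X)
    (f.hasMFDerivAt x)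
  rw [extendZero_apply] at h
  have hL : (ContinuousLinearMap.toSpanSingleton ℂ (Complex.exp (f x))).comp (f.d.1 x) =
      (Forms.smul f.exp f.d).1 x :=
    ContinuousLinearMap.ext fun v => mul_comm (f.d.1 x v) (Complex.exp (f x))
  rw [← hL]
  refine h.congr_of_eventuallyEq ?_
  filter_upwards [U.isOpen.mem_nhds x.2] with y hy
  exact (extendZero_apply _ ⟨y, hy⟩).trans (congrArg Complex.exp
    (extendZero_apply _ ⟨y, hy⟩).symm)

lemma Hol.d_const (U : Opens X) (c : ℂ) : (Hol.const (n := n) U c).d = 0 := by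
  refine Subtype.ext (funext fun x => Hol.d_eq _ x _ ?_)
  refine (hasMFDerivAt_const c (x : X)).congr_of_eventuallyEq ?_
  filter_upwards [U.isOpen.mem_nhds x.2] with y hy
  exact extendZero_apply _ ⟨y, hy⟩

lemma Hol.dlog_expUnit {U : Opens X} (f : Hol n X U) : Hol.dlog f.expUnit = f.d := by
  unfold Hol.dlog
  change Forms.smul _ f.exp.d = _
  rw [Hol.d_exp, ← Forms.mul_smul]
  have h : (f.expUnit⁻¹ : (Hol n X U)ˣ).val * f.exp = 1 := f.expUnit.inv_mul
  rw [h]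
  exact Subtype.ext (funext fun x => one_smul ℂ (f.d.1 x))

/-- From `a = exp u` comes `a du = da`, and likewise `(1 - a) dv = d(1 - a) = -da`; these two terms
cancel, leaving `u da + v d(1 - a)`. -/
lemma d_entropy (a : Hol n X ⊤) {U : Opens X} (u v : Hol n X U) (h : IsLogPair a u v) :
    (entropy a u v).d = Forms.smul (u - v) (Hol.res le_top a : Hol n X U).d := by
  obtain ⟨hu, hv⟩ := h
  have hsum : (Hol.res le_top a : Hol n X U) + Hol.res le_top (1 - a) = Hol.const U 1 :=
    DFunLike.ext _ _ fun x => add_sub_cancel _ (1 : ℂ)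
  have hd := (Hol.d_add _ _).symm.trans ((congrArg Hol.d hsum).trans (Hol.d_const U 1))
  have hu' := (Hol.d_exp u).symm
  have hv' := (Hol.d_exp v).symm
  unfold entropy
  rw [hu] at hu'
  rw [hv] at hv'
  rw [Hol.d_add, Hol.d_mul, Hol.d_mul, hu', hv', eq_neg_of_add_eq_zero_right hd]
  refine Subtype.ext (funext fun x => ContinuousLinearMap.ext fun w => ?_)
  change ((Hol.res le_top a : Hol n X U).d.1 x w + u x * (Hol.res le_top a : Hol n X U).d.1 x w) +
    (-(Hol.res le_top a : Hol n X U).d.1 x w + v x * -(Hol.res le_top a : Hol n X U).d.1 x w) =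
    (u x - v x) * (Hol.res le_top a : Hol n X U).d.1 x w
  generalize (Hol.res le_top a : Hol n X U).d.1 x w = t
  change ℂ at t
  ring

end Branches

/-! ### Sections of associated sheaves -/

section AssociatedSheaf

variable {X : Type u} [TopologicalSpace X]

lemma Sh.eq_of_locally_eq (F : Sh X) {U : Opens X} (s t : F.obj.obj (op U))
    (h : ∀ x ∈ U, ∃ (V : Opens X) (i : V ≤ U), x ∈ V ∧
      F.obj.map (homOfLE i).op s = F.obj.map (homOfLE i).op t) : s = t := by
  choose! V i hxV hst using h
  refine TopCat.Sheaf.eq_of_locally_eq' (X := TopCat.of X) F (fun x : U => V x) U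
    (fun x => homOfLE (i x x.2)) (fun x hx => ?_) s t (fun x => hst x x.2)
  exact Opens.mem_iSup.2 ⟨⟨x, hx⟩, hxV x hx⟩

lemma map_toSection {F : (Opens X)ᵒᵖ ⥤ AddCommGrpCat.{u}} {U V : Opens X} (i : V ⟶ U)
    (x : F.obj (op U)) :
    (assocSheaf F).obj.map i.op (toSection U x) = toSection V (F.map i.op x) :=
  (ConcreteCategory.congr_hom
    ((toSheafify (Opens.grothendieckTopology X) F).naturality i.op) x).symm

/-- The unit of sheafification is locally surjective. -/
lemma exists_toSection_eq {F : (Opens X)ᵒᵖ ⥤ AddCommGrpCat.{u}} {U : Opens X}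
    (s : (assocSheaf F).obj.obj (op U)) {x : X} (hx : x ∈ U) :
    ∃ (V : Opens X) (i : V ≤ U), x ∈ V ∧ ∃ y : F.obj (op V),
      toSection V y = (assocSheaf F).obj.map (homOfLE i).op s := by
  obtain ⟨V, i, ⟨y, hy⟩, hxV⟩ := Presheaf.imageSieve_mem (Opens.grothendieckTopology X)
    (toSheafify (Opens.grothendieckTopology X) F) (U := op U) s x hx
  exact ⟨V, leOfHom i, hxV, y, hy⟩

/-- The unit of sheafification is locally injective. -/
lemma exists_map_eq_of_toSection_eq {F : (Opens X)ᵒᵖ ⥤ AddCommGrpCat.{u}} {U : Opens X}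
    {y z : F.obj (op U)} (h : toSection U y = toSection U z) {x : X} (hx : x ∈ U) :
    ∃ (V : Opens X) (i : V ≤ U), x ∈ V ∧
      F.map (homOfLE i).op y = F.map (homOfLE i).op z := by
  obtain ⟨V, i, hi, hxV⟩ := Presheaf.equalizerSieve_mem (Opens.grothendieckTopology X)
    (toSheafify (Opens.grothendieckTopology X) F) (X := op U) y z h x hx
  exact ⟨V, leOfHom i, hxV, hi⟩

lemma presheafToSheaf_map_toSection {F G : (Opens X)ᵒᵖ ⥤ AddCommGrpCat.{u}} (φ : F ⟶ G)
    {U : Opens X} (x : F.obj (op U)) :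
    ((presheafToSheaf (Opens.grothendieckTopology X) AddCommGrpCat.{u}).map φ).hom.app (op U)
      (toSection U x) = toSection U (φ.app (op U) x) :=
  (ConcreteCategory.congr_hom (NatTrans.congr_app
    (toSheafify_naturality (Opens.grothendieckTopology X) φ) (op U)) x).symm

lemma sheafLift_toSection {F : (Opens X)ᵒᵖ ⥤ AddCommGrpCat.{u}} {G : Sh X} (φ : F ⟶ G.obj)
    {U : Opens X} (x : F.obj (op U)) :
    (sheafLift φ).hom.app (op U) (toSection U x) = φ.app (op U) x := by
  have h := (sheafificationAdjunction (Opens.grothendieckTopology X) AddCommGrpCat.{u}).homEquiv_unit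
    (f := sheafLift φ)
  rw [Equiv.apply_symm_apply] at h
  exact (ConcreteCategory.congr_hom (NatTrans.congr_app h (op U)) x).symm

/-- Two morphisms from an associated sheaf coincide if they agree on sections of the presheaf. -/
lemma assocSheaf_hom_ext {F : (Opens X)ᵒᵖ ⥤ AddCommGrpCat.{u}} {G : Sh X}
    {φ ψ : assocSheaf F ⟶ G} (h : ∀ (U : Opens X) (x : F.obj (op U)),
      φ.hom.app (op U) (toSection U x) = ψ.hom.app (op U) (toSection U x)) : φ = ψ := by
  refine ((sheafificationAdjunction (Opens.grothendieckTopology X) AddCommGrpCat.{u}).homEquiv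
    _ _).injective (NatTrans.ext (funext fun U => ConcreteCategory.hom_ext _ _ fun x => ?_))
  rw [Adjunction.homEquiv_unit, Adjunction.homEquiv_unit]
  exact h U.unop x

/-- Two morphisms from the sheaf associated with a tensor product coincide if they agree on pure
tensors. -/
lemma assocSheaf_tensor_hom_ext {F G : (Opens X)ᵒᵖ ⥤ AddCommGrpCat.{u}} {H : Sh X}
    {φ ψ : assocSheaf (tensorPresheaf F G) ⟶ H}
    (h : ∀ (U : Opens X) (a : F.obj (op U)) (b : G.obj (op U)),
      φ.hom.app (op U) (toSection (F := tensorPresheaf F G) U (a ⊗ₜ[ℤ] b)) =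
        ψ.hom.app (op U) (toSection (F := tensorPresheaf F G) U (a ⊗ₜ[ℤ] b))) : φ = ψ := by
  refine assocSheaf_hom_ext fun U x => ?_
  change F.obj (op U) ⊗[ℤ] G.obj (op U) at x
  let t := ((toSheafify (Opens.grothendieckTopology X) (tensorPresheaf F G)).app (op U)).hom
  change ((φ.hom.app (op U)).hom.comp t) x = ((ψ.hom.app (op U)).hom.comp t) x
  induction x using TensorProduct.induction_on with
  | zero => exact (map_zero _).trans (map_zero _).symm
  | tmul a b => exact h U a b
  | add a b ha hb =>
    exact (map_add _ _ _).trans ((congrArg₂ (· + ·) ha hb).trans (map_add _ _ _).symm)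

end AssociatedSheaf

lemma _root_.TensorProduct.addMonoidHom_ext {A B C : Type*} [AddCommGroup A] [AddCommGroup B]
    [AddCommGroup C] {φ ψ : A ⊗[ℤ] B →+ C} (h : ∀ a b, φ (a ⊗ₜ b) = ψ (a ⊗ₜ b)) : φ = ψ := by
  ext x
  induction x using TensorProduct.induction_on with
  | zero => rw [map_zero, map_zero]
  | tmul a b => exact h a b
  | add a b ha hb => rw [map_add, map_add, ha, hb]

/-! ### Exactness of the exponential sequence tensored with `𝒪` -/

section Exactness

variable (n : ℕ) (X : Type u) [TopologicalSpace X] [ChartedSpace (Model n) X]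

/-- The generator `2πi` of `ℤ(1)`. -/
def twoPiI : Z1 := ⟨2 * Real.pi * Complex.I, AddSubgroup.mem_zmultiples _⟩

variable {n X} in
lemma Hol.const_inv_mul_const (U : Opens X) :
    Hol.const (n := n) U (1 / (2 * Real.pi * Complex.I)) *
      Hol.const U (2 * Real.pi * Complex.I) = 1 :=
  DFunLike.ext _ _ fun _ => one_div_mul_cancel Complex.two_pi_I_ne_zero

variable {n X} in
/-- The biadditive map `(a, b) ↦ (ab / 2πi) ⊗ 2πi`. -/
def retrBi (U : Opens X) : Hol n X U →+ Hol n X U →+ Hol n X U ⊗[ℤ] Z1 :=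
  AddMonoidHom.mk' (fun a => AddMonoidHom.mk'
    (fun b => (Hol.const U (1 / (2 * Real.pi * Complex.I)) * (a * b)) ⊗ₜ[ℤ] twoPiI)
    (fun b c => by rw [mul_add, mul_add, TensorProduct.add_tmul]))
    (fun a b => AddMonoidHom.ext fun c => by
      change (Hol.const U _ * ((a + b) * c)) ⊗ₜ[ℤ] twoPiI =
        (Hol.const U _ * (a * c)) ⊗ₜ[ℤ] twoPiI + (Hol.const U _ * (b * c)) ⊗ₜ[ℤ] twoPiI
      rw [add_mul, mul_add, TensorProduct.add_tmul])

/-- The map of presheaves that underlies the retraction `𝒪 ⊗ 𝒪 → 𝒪(1)`. -/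
def retrPre : tensorPresheaf (O n X) (O n X) ⟶
    tensorPresheaf (O n X) ((Functor.const _).obj (AddCommGrpCat.of Z1)) :=
  tensorLift (P := tensorPresheaf (O n X) ((Functor.const _).obj (AddCommGrpCat.of Z1)))
    (fun U => retrBi U.unop) (fun _ _ _ => rfl)

/-- The map `𝒪 ⊗ 𝒪 → 𝒪(1)`, `a ⊗ b ↦ (ab / 2πi) ⊗ 2πi`. -/
def retr : OO n X ⟶ O1 n X := (presheafToSheaf _ _).map (retrPre n X)

/-- For `z = k · 2πi` the factor `z / 2πi` is the integer `k`, which passes through the tensor sign.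
-/
lemma inclPre_retrPre : inclPre n X ≫ retrPre n X = 𝟙 _ := by
  refine NatTrans.ext (funext fun U => ConcreteCategory.hom_ext _ _ fun x => ?_)
  change Hol n X U.unop ⊗[ℤ] Z1 at x
  induction x using TensorProduct.induction_on with
  | zero => exact (map_zero _).trans (map_zero _).symm
  | tmul a z =>
    change (Hol.const U.unop (1 / (2 * Real.pi * Complex.I)) *
      (a * Hol.const U.unop (z : ℂ))) ⊗ₜ[ℤ] twoPiI = a ⊗ₜ[ℤ] z
    obtain ⟨k, hk⟩ := AddSubgroup.mem_zmultiples_iff.1 z.2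
    have hz : z = k • twoPiI := Subtype.ext hk.symm
    have ha : Hol.const U.unop (1 / (2 * Real.pi * Complex.I)) * (a * Hol.const U.unop (z : ℂ)) =
        k • a := by
      have hc : Hol.const (n := n) U.unop (z : ℂ) =
          k • Hol.const U.unop (2 * Real.pi * Complex.I) := by
        rw [← hk]
        exact (AddMonoidHom.mk' (Hol.const (n := n) U.unop) (Hol.const_add _)).map_zsmul _ _
      rw [hc, mul_left_comm, mul_smul_comm, Hol.const_inv_mul_const, mul_smul_comm, mul_one]
    rw [ha, hz, TensorProduct.smul_tmul]
  | add a b ha hb =>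
    exact (map_add _ _ _).trans ((congrArg₂ (· + ·) ha hb).trans (map_add _ _ _).symm)

lemma incl_retr : incl n X ≫ retr n X = 𝟙 _ :=
  ((presheafToSheaf _ _).map_comp _ _).symm.trans
    ((congrArg _ (inclPre_retrPre n X)).trans ((presheafToSheaf _ _).map_id _))

variable {n X} in
-- Functions with values in `ℂ` form a torsion-free group, and torsion-free modules over a principal
-- ideal domain are flat.
instance Hol.flat_int (U : Opens X) : Module.Flat ℤ (Hol n X U) := by
  have : Module.IsTorsionFree ℤ (Hol n X U) := by
    refine ⟨fun k hk f g h => DFunLike.ext _ _ fun x => ?_⟩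
    let e : Hol n X U →+ ℂ := AddMonoidHom.mk' (fun f => f x) fun _ _ => rfl
    have hx : k • e f = k • e g := by
      rw [← map_zsmul, ← map_zsmul]
      exact congrArg e h
    exact smul_right_injective ℂ (IsRegular.ne_zero hk) hx
  infer_instance

variable {n X} in
/-- On a connected open set the sequence `𝒪(1) → 𝒪 ⊗ 𝒪 → 𝒪 ⊗ 𝒪ˣ` of presheaves is exact. -/
lemma exists_inclPre_eq {U : Opens X} (hU : IsPreconnected (U : Set X))
    (x : Hol n X U ⊗[ℤ] Hol n X U) (hx : (expPre n X).app (op U) x = 0) :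
    ∃ y : Hol n X U ⊗[ℤ] Z1, (inclPre n X).app (op U) y = x := by
  let f : Z1 →ₗ[ℤ] Hol n X U :=
    (AddMonoidHom.mk' (fun z : Z1 => Hol.const (n := n) U (z : ℂ)) fun z w =>
      Hol.const_add U _ _).toIntLinearMap
  let g : Hol n X U →ₗ[ℤ] Additive (Hol n X U)ˣ :=
    (AddMonoidHom.mk' (fun b : Hol n X U => Additive.ofMul b.expUnit) fun b c =>
      congrArg Additive.ofMul (Hol.expUnit_add b c)).toIntLinearMap
  have hfg : Function.Exact f g := fun b => by
    constructor
    · intro hb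
      obtain ⟨z, hz⟩ := Hol.exists_eq_const hU (f := b) (congrArg Units.val hb)
      exact ⟨z, hz.symm⟩
    · rintro ⟨z, rfl⟩
      exact congrArg Additive.ofMul (exp_Z1 n X U z)
  -- Surjectivity of `exp` on `U`, which can fail, is not needed: flatness preserves exactness in
  -- the middle.
  have h := Module.Flat.lTensor_exact (Hol n X U) hfg
  have hg : (g.lTensor (Hol n X U)) x = 0 := by
    refine Eq.trans ?_ hx
    exact DFunLike.congr_fun (TensorProduct.addMonoidHom_ext
      (φ := (g.lTensor (Hol n X U)).toAddMonoidHom) (ψ := ((expPre n X).app (op U)).hom)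
      fun _ _ => rfl) x
  obtain ⟨y, rfl⟩ := (h x).1 hg
  exact ⟨y, DFunLike.congr_fun (TensorProduct.addMonoidHom_ext
    (φ := ((inclPre n X).app (op U)).hom) (ψ := (f.lTensor (Hol n X U)).toAddMonoidHom)
    fun _ _ => rfl) y⟩

variable {n X} in
/-- A local section of `𝒪 ⊗ 𝒪` in the kernel of `𝒪 ⊗ 𝒪 → 𝒪 ⊗ 𝒪ˣ` is the image of its retraction. -/
lemma incl_retr_app_of_expMap_eq_zero {U : Opens X} (s : (OO n X).obj.obj (op U))
    (hs : (expMap n X).hom.app (op U) s = 0) :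
    (retr n X ≫ incl n X).hom.app (op U) s = s := by
  refine Sh.eq_of_locally_eq (OO n X) _ _ fun x hx => ?_
  -- Three shrinkings: to `V`, where `s` comes from a tensor; to `V'`, where the image of that
  -- tensor vanishes already in the presheaf; to a connected `W`, where the kernel is known.
  obtain ⟨V, i, hxV, y, hy⟩ := exists_toSection_eq s hx
  have h1 : toSection (F := tensorPresheaf (O n X) (Ounits n X)) V ((expPre n X).app (op V) y) =
      toSection V 0 := by
    refine (presheafToSheaf_map_toSection (expPre n X) y).symm.trans ?_
    rw [hy]
    refine (ConcreteCategory.congr_hom ((expMap n X).hom.naturality (homOfLE i).op) s).trans ?_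
    refine (congrArg ((OOx n X).obj.map (homOfLE i).op) hs).trans ?_
    exact (map_zero ((OOx n X).obj.map (homOfLE i).op).hom).trans
      (map_zero ((toSheafify (Opens.grothendieckTopology X)
        (tensorPresheaf (O n X) (Ounits n X))).app (op V)).hom).symm
  obtain ⟨V', i', hxV', h2⟩ := exists_map_eq_of_toSection_eq h1 hxV
  obtain ⟨W, j, hxW, hW⟩ := exists_isPreconnected_nhd n V' hxV'
  have hWU : W ≤ U := (j.trans i').trans i
  let y' : (tensorPresheaf (O n X) (O n X)).obj (op W) :=
    (tensorPresheaf (O n X) (O n X)).map (homOfLE (j.trans i')).op y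
  have hy' : toSection W y' = (OO n X).obj.map (homOfLE hWU).op s := by
    refine (map_toSection (homOfLE (j.trans i')) y).symm.trans ?_
    rw [hy]
    exact (ConcreteCategory.congr_hom ((OO n X).obj.map_comp (homOfLE i).op
      (homOfLE (j.trans i')).op) s).symm
  have h3 : (expPre n X).app (op W) y' = 0 := by
    have h4 : (expPre n X).app (op V') ((tensorPresheaf (O n X) (O n X)).map (homOfLE i').op y) =
        0 := by
      refine (ConcreteCategory.congr_hom ((expPre n X).naturality (homOfLE i').op) y).trans ?_
      exact h2.trans (map_zero
        ((tensorPresheaf (O n X) (Ounits n X)).map (homOfLE i').op).hom)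
    have h5 : y' = (tensorPresheaf (O n X) (O n X)).map (homOfLE j).op
        ((tensorPresheaf (O n X) (O n X)).map (homOfLE i').op y) :=
      ConcreteCategory.congr_hom ((tensorPresheaf (O n X) (O n X)).map_comp (homOfLE i').op
        (homOfLE j).op) y
    rw [h5]
    refine (ConcreteCategory.congr_hom ((expPre n X).naturality (homOfLE j).op) _).trans ?_
    exact (congrArg ((tensorPresheaf (O n X) (Ounits n X)).map (homOfLE j).op) h4).trans
      (map_zero ((tensorPresheaf (O n X) (Ounits n X)).map (homOfLE j).op).hom)
  obtain ⟨z, hz⟩ := exists_inclPre_eq hW y' h3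
  refine ⟨W, hWU, hxW, ?_⟩
  refine (ConcreteCategory.congr_hom ((retr n X ≫ incl n X).hom.naturality
    (homOfLE hWU).op) s).symm.trans ?_
  change (retr n X ≫ incl n X).hom.app (op W) ((OO n X).obj.map (homOfLE hWU).op s) = _
  have hz' : (incl n X).hom.app (op W) (toSection W z) = (OO n X).obj.map (homOfLE hWU).op s :=
    (presheafToSheaf_map_toSection (inclPre n X) z).trans ((congrArg _ hz).trans hy')
  -- Over `W` the section `s` is `incl z`, and `retr` recovers `z` from it.
  rw [← hz']
  exact congrArg ((incl n X).hom.app (op W)) (ConcreteCategory.congr_hom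
    (NatTrans.congr_app (congrArg (fun φ => φ.hom) (incl_retr n X)) (op W)) (toSection W z))

/-- The short complex `𝒪(1) → 𝒪 ⊗ 𝒪 → 𝒪 ⊗ 𝒪ˣ` of sheaves. -/
abbrev sheafSequence : ShortComplex (Sh X) :=
  ShortComplex.mk (incl n X) (expMap n X) (incl_exp n X)

instance mono_incl : Mono (incl n X) :=
  (SplitMono.mk (retr n X) (incl_retr n X)).mono

lemma comp_retr_incl {F : Sh X} (φ : F ⟶ OO n X) (hφ : φ ≫ expMap n X = 0) :
    (φ ≫ retr n X) ≫ incl n X = φ := by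
  refine Sheaf.hom_ext (NatTrans.ext (funext fun U => ConcreteCategory.hom_ext _ _ fun s => ?_))
  exact incl_retr_app_of_expMap_eq_zero (U := U.unop) (φ.hom.app U s) (ConcreteCategory.congr_hom
    (NatTrans.congr_app (congrArg (fun φ => φ.hom) hφ) U) s)

/-- The retraction gives the universal property of the kernel explicitly: a morphism `φ` killed by
`expMap` factors through `incl` via `φ ≫ retr`. -/
lemma sheafSequence_exact : (sheafSequence n X).Exact :=
  ShortComplex.exact_of_f_is_kernel _ (Limits.KernelFork.IsLimit.ofι _ _
    (fun φ _ => φ ≫ retr n X) (fun φ hφ => comp_retr_incl n X φ hφ)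
    (fun φ hφ _ hm => (cancel_mono (incl n X)).1 (hm.trans (comp_retr_incl n X φ hφ).symm)))

variable {n X} in
/-- Sections of `𝒪 ⊗ 𝒪ˣ` lift locally to `𝒪 ⊗ 𝒪`. -/
lemma exists_expPre_eq {U : Opens X} (s : Hol n X U ⊗[ℤ] Additive (Hol n X U)ˣ) {x : X}
    (hx : x ∈ U) : ∃ (V : Opens X) (i : V ≤ U), x ∈ V ∧
      ∃ t : (tensorPresheaf (O n X) (O n X)).obj (op V), (expPre n X).app (op V) t =
        (tensorPresheaf (O n X) (Ounits n X)).map (homOfLE i).op s := by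
  induction s using TensorProduct.induction_on with
  | zero =>
    exact ⟨U, le_rfl, hx, 0, (map_zero ((expPre n X).app (op U)).hom).trans (map_zero
      ((tensorPresheaf (O n X) (Ounits n X)).map (homOfLE (le_refl U)).op).hom).symm⟩
  | tmul a f =>
    -- A local logarithm `g` of `f` gives the lift `a ⊗ g`; for sums the neighbourhoods are
    -- intersected.
    obtain ⟨V, i, hxV, g, hg⟩ := Hol.exists_local_log f.toMul hx
    refine ⟨V, i, hxV, (Hol.res i a : Hol n X V) ⊗ₜ[ℤ] g, ?_⟩
    exact congrArg (fun t : Additive (Hol n X V)ˣ => (Hol.res i a : Hol n X V) ⊗ₜ[ℤ] t)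
      (Additive.toMul.injective (Units.ext hg))
  | add a b ha hb =>
    obtain ⟨V, i, hxV, t, ht⟩ := ha
    obtain ⟨V', i', hxV', t', ht'⟩ := hb
    have key : ∀ {W : Opens X} (j : W ≤ U) (r : (tensorPresheaf (O n X) (O n X)).obj (op W))
        (c : (tensorPresheaf (O n X) (Ounits n X)).obj (op U)) (k : V ⊓ V' ≤ W),
        (expPre n X).app (op W) r = (tensorPresheaf (O n X) (Ounits n X)).map (homOfLE j).op c →
        (expPre n X).app (op (V ⊓ V')) ((tensorPresheaf (O n X) (O n X)).map (homOfLE k).op r) =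
        (tensorPresheaf (O n X) (Ounits n X)).map (homOfLE (inf_le_left.trans i)).op c := by
      intro W j r c k h
      refine (ConcreteCategory.congr_hom ((expPre n X).naturality (homOfLE k).op) r).trans ?_
      refine (congrArg ((tensorPresheaf (O n X) (Ounits n X)).map (homOfLE k).op) h).trans ?_
      exact (ConcreteCategory.congr_hom ((tensorPresheaf (O n X) (Ounits n X)).map_comp
        (homOfLE j).op (homOfLE k).op) c).symm
    refine ⟨V ⊓ V', inf_le_left.trans i, ⟨hxV, hxV'⟩,
      (tensorPresheaf (O n X) (O n X)).map (homOfLE inf_le_left).op t +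
        (tensorPresheaf (O n X) (O n X)).map (homOfLE inf_le_right).op t', ?_⟩
    refine (map_add ((expPre n X).app (op (V ⊓ V'))).hom _ _).trans ?_
    refine (congrArg₂ (· + ·) (key i t a inf_le_left ht) (key i' t' b inf_le_right ht')).trans ?_
    exact (map_add ((tensorPresheaf (O n X) (Ounits n X)).map
      (homOfLE (inf_le_left.trans i)).op).hom a b).symm

instance epi_expMap : Epi (expMap n X) := by
  have : Presheaf.IsLocallySurjective (Opens.grothendieckTopology X) (expPre n X) :=
    ⟨fun {U} s x hx => by
      obtain ⟨V, i, hxV, t, ht⟩ := exists_expPre_eq s hx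
      exact ⟨V, homOfLE i, ⟨t, ht⟩, hxV⟩⟩
  have : Sheaf.IsLocallySurjective (expMap n X) :=
    (Presheaf.isLocallySurjective_presheafToSheaf_map_iff _ _).2 this
  infer_instance

lemma sheafSequence_shortExact : (sheafSequence n X).ShortExact :=
  { exact := sheafSequence_exact n X }

end Exactness

/-! ### The connecting morphism of a degreewise split sequence -/

section ConnectingMorphism

open CochainComplex CochainComplex.HomComplex

universe w v u'

variable {C : Type u'} [Category.{v} C] [Abelian C] [HasDerivedCategory.{w} C]

/-- Two morphisms from a mapping cone coincide in the derived category if the homotopy given by a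
family of retractions `ρ` relates them. -/
lemma Q_map_eq_of_retraction {S : ShortComplex (CochainComplex C ℤ)}
    (ρ : ∀ p, S.X₂.X p ⟶ S.X₁.X p) (hρ : ∀ p, S.f.f p ≫ ρ p = 𝟙 _)
    (τ : S.X₃ ⟶ S.X₁⟦(1 : ℤ)⟧)
    (hτ : ∀ p, S.g.f p ≫ τ.f p =
      (S.X₂.d p (p + 1) ≫ ρ (p + 1) - ρ p ≫ S.X₁.d p (p + 1)) ≫
        (S.X₁.shiftFunctorObjXIso 1 p (p + 1) rfl).inv)
    (M : mappingCone S.f ⟶ S.X₁⟦(1 : ℤ)⟧) (hM : mappingCone.inr S.f ≫ M = 0)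
    (hM' : ∀ (q : ℤ) (hq : q + 1 + (-1) = q), (mappingCone.inl S.f).v (q + 1) q hq ≫ M.f q =
        -(S.X₁.shiftFunctorObjXIso 1 q (q + 1) rfl).inv) :
    DerivedCategory.Q.map M = DerivedCategory.Q.map (mappingCone.descShortComplex S ≫ τ) := by
  -- The homotopy out of the cone is zero on the `S.X₁` part and the shifted `-ρ` on the `S.X₂`
  -- part.
  refine DerivedCategory.Q_map_eq_of_homotopy C (mappingCone.descHomotopy S.f _ _ 0
    (-(Cochain.ofHoms ρ).rightShift 1 (-1) (by simp)) ?_ ?_)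
  -- On the `S.X₁` part, `M` is minus the identity up to the shift, which matches `S.f` followed by
  -- `-ρ`; the map through `S.X₃` vanishes there.
  · ext p q hpq
    have h : p = q + 1 := by omega
    subst h
    have e2 : (mappingCone.inl S.f).v (q + 1) q hpq ≫
        (mappingCone.descShortComplex S ≫ τ).f q = 0 := by
      rw [HomologicalComplex.comp_f, mappingCone.inl_v_descShortComplex_f_assoc, Limits.zero_comp]
    have e3 : ((Cochain.ofHoms ρ).rightShift 1 (-1) (by simp)).v (q + 1) q hpq =
        ρ (q + 1) ≫ (S.X₁.shiftFunctorObjXIso 1 q (q + 1) rfl).inv := by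
      rw [Cochain.rightShift_v _ 1 (-1) _ (q + 1) q hpq (q + 1) (by simp), Cochain.ofHoms_v]
    rw [Cochain.add_v, Cochain.add_v, Cochain.comp_zero_cochain_v, Cochain.comp_zero_cochain_v,
      Cochain.zero_cochain_comp_v, Cochain.ofHom_v, Cochain.ofHom_v, Cochain.ofHom_v,
      Cochain.neg_v, e3, e2, δ_zero, Cochain.zero_v, Preadditive.comp_neg,
      reassoc_of% (hρ (q + 1))]
    exact (hM' q hpq).trans ((zero_add _).symm.trans (add_zero _).symm)
  -- On the `S.X₂` part `M` vanishes. The sign from differentiating a shifted cochain cancels that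
  -- of `-ρ`, so the boundary of the homotopy is `ρ d - d ρ`, opposite to `S.g ≫ τ`.
  · ext p
    have e3 : ((δ 0 1 (Cochain.ofHoms ρ)).rightShift 1 0 (by simp)).v p p (by simp) =
        (ρ p ≫ S.X₁.d p (p + 1) - S.X₂.d p (p + 1) ≫ ρ (p + 1)) ≫
          (S.X₁.shiftFunctorObjXIso 1 p (p + 1) rfl).inv := by
      rw [Cochain.rightShift_v _ 1 0 _ p p _ (p + 1) rfl, δ_zero_cochain_v, Cochain.ofHoms_v,
        Cochain.ofHoms_v]
    rw [hM, Cochain.add_v, Cochain.ofHom_v, Cochain.ofHom_v, δ_neg,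
      Cochain.δ_rightShift _ 1 (-1) 0 (by simp) 1 (by simp),
      mappingCone.inr_descShortComplex_assoc, HomologicalComplex.comp_f, hτ]
    simp only [Int.negOnePow_one, Units.neg_smul, one_smul, neg_neg]
    rw [e3, ← Preadditive.add_comp, sub_add_sub_cancel, sub_self, Limits.zero_comp,
      HomologicalComplex.zero_f]

/-- The connecting morphism of a degreewise split short exact sequence of complexes, in terms of a
family of retractions `ρ`. -/
lemma triangleOfSESδ_eq_of_retraction {S : ShortComplex (CochainComplex C ℤ)} (hS : S.ShortExact)
    (ρ : ∀ p, S.X₂.X p ⟶ S.X₁.X p) (hρ : ∀ p, S.f.f p ≫ ρ p = 𝟙 _)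
    (τ : S.X₃ ⟶ S.X₁⟦(1 : ℤ)⟧)
    (hτ : ∀ p, S.g.f p ≫ τ.f p =
      (S.X₂.d p (p + 1) ≫ ρ (p + 1) - ρ p ≫ S.X₁.d p (p + 1)) ≫
        (S.X₁.shiftFunctorObjXIso 1 p (p + 1) rfl).inv) :
    DerivedCategory.triangleOfSESδ hS = DerivedCategory.Q.map τ ≫
      (DerivedCategory.Q.commShiftIso (1 : ℤ)).hom.app S.X₁ := by
  have := CochainComplex.mappingCone.quasiIso_descShortComplex hS
  -- The connecting morphism inverts the quasi-isomorphism from the cone to `S.X₃`; after moving it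
  -- across, two maps out of the cone are compared.
  rw [DerivedCategory.triangleOfSESδ, IsIso.inv_comp_eq, ← Category.assoc, ← Functor.map_comp]
  exact congrArg (fun φ => φ ≫ (DerivedCategory.Q.commShiftIso (1 : ℤ)).hom.app S.X₁)
    (Q_map_eq_of_retraction ρ hρ τ hτ _ (mappingCone.inr_triangleδ S.f)
      fun q hq => mappingCone.inl_v_triangle_mor₃_f S.f (q + 1) q hq)

end ConnectingMorphism

/-! ### The connecting map and the logarithmic differential -/

section Boundary

variable (n : ℕ) (X : Type u) [TopologicalSpace X] [ChartedSpace (Model n) X]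
  [IsManifold 𝓘(ℂ, Model n) ω X]

lemma connMap_toSection (U : Opens X) (a b : Hol n X U) :
    (connMap n X).hom.app (op U) (toSection (F := tensorPresheaf (O n X) (O n X)) U (a ⊗ₜ[ℤ] b)) =
      Forms.smul b a.d :=
  sheafLift_toSection _ _

lemma dlogMap_toSection (U : Opens X) (a : Hol n X U) (f : (Hol n X U)ˣ) :
    (dlogMap n X).hom.app (op U)
      (toSection (F := tensorPresheaf (O n X) (Ounits n X)) U (a ⊗ₜ[ℤ] Additive.ofMul f)) =
      Forms.smul a (Hol.dlog f) :=
  sheafLift_toSection _ _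

/-- On `a ⊗ b` this is the Leibniz rule: the left side gives `2πi · d(ab / 2πi) = d(ab)`, and `dlog
(exp b) = db`. -/
lemma retr_connMap1 : retr n X ≫ connMap1 n X = connMap n X + expMap n X ≫ dlogMap n X := by
  refine assocSheaf_tensor_hom_ext fun U a b => ?_
  change Hol n X U at a b
  have h1 : (retr n X ≫ connMap1 n X).hom.app (op U)
      (toSection (F := tensorPresheaf (O n X) (O n X)) U (a ⊗ₜ[ℤ] b)) =
      Forms.smul (Hol.const U (2 * Real.pi * Complex.I) : Hol n X U)
        (Hol.const U (1 / (2 * Real.pi * Complex.I)) * (a * b) : Hol n X U).d := by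
    refine (congrArg ((connMap1 n X).hom.app (op U)) (presheafToSheaf_map_toSection (retrPre n X)
      (U := U) (a ⊗ₜ[ℤ] b))).trans ?_
    refine (congrArg ((connMap n X).hom.app (op U)) (presheafToSheaf_map_toSection (inclPre n X)
      (U := U) _)).trans ?_
    exact connMap_toSection n X U _ _
  have h2 : (expMap n X ≫ dlogMap n X).hom.app (op U)
      (toSection (F := tensorPresheaf (O n X) (O n X)) U (a ⊗ₜ[ℤ] b)) = Forms.smul a b.d := by
    refine (congrArg ((dlogMap n X).hom.app (op U)) (presheafToSheaf_map_toSection (expPre n X)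
      (U := U) (a ⊗ₜ[ℤ] b))).trans ?_
    exact (dlogMap_toSection n X U a b.expUnit).trans
      (congrArg (Forms.smul a) (Hol.dlog_expUnit b))
  refine h1.trans (Eq.trans ?_ (congrArg₂ (· + ·) (connMap_toSection n X U a b) h2).symm)
  have hzero : Forms.smul (a * b) (0 : Forms n X U) = 0 :=
    Subtype.ext (funext fun x => ContinuousLinearMap.ext fun v =>
      mul_zero ((a * b) x))
  rw [Hol.d_mul, Hol.d_const, hzero, add_zero, ← Forms.mul_smul, mul_comm,
    Hol.const_inv_mul_const, Hol.d_mul]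
  refine Eq.trans ?_ (add_comm (Forms.smul a b.d) (Forms.smul b a.d))
  exact Subtype.ext (funext fun x => one_smul ℂ _)

lemma expSequence_shortExact : (expSequence n X).ShortExact := by
  refine HomologicalComplex.shortExact_of_degreewise_shortExact _ fun i => ?_
  by_cases h0 : i = 0
  · subst h0
    refine ShortComplex.shortExact_of_iso (ShortComplex.isoMk
      (S₁ := sheafSequence n X)
      (HomologicalComplex.doubleXIso₀ (c := ComplexShape.up ℤ) (connMap1 n X) (by simp)).symm
      (HomologicalComplex.doubleXIso₀ (c := ComplexShape.up ℤ) (connMap n X) (by simp)).symm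
      (HomologicalComplex.singleObjXSelf (ComplexShape.up ℤ) 0 (OOx n X)).symm ?_ ?_)
      (sheafSequence_shortExact n X)
    · change (HomologicalComplex.doubleXIso₀ (connMap1 n X) _).inv ≫ (complexIncl n X).f 0 =
        incl n X ≫ (HomologicalComplex.doubleXIso₀ (connMap n X) _).inv
      simp [complexIncl]
    · change (HomologicalComplex.doubleXIso₀ (connMap n X) _).inv ≫ (complexExp n X).f 0 =
        expMap n X ≫ (HomologicalComplex.singleObjXSelf (ComplexShape.up ℤ) 0 (OOx n X)).inv
      simp [complexExp]
  -- Outside degree `0` the quotient is zero, so it suffices that the inclusion is an isomorphism: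
  -- the identity of `Ω¹` in degree `1`, and a map of zero objects elsewhere.
  have hX₃ : Limits.IsZero (((expSequence n X).map (HomologicalComplex.eval _ _ i)).X₃) :=
    HomologicalComplex.isZero_single_obj_X (ComplexShape.up ℤ) 0 (OOx n X) i h0
  have hg : ((expSequence n X).map (HomologicalComplex.eval _ _ i)).g = 0 := hX₃.eq_of_tgt _ _
  have hf : IsIso ((expSequence n X).map (HomologicalComplex.eval _ _ i)).f := by
    change IsIso ((complexIncl n X).f i)
    by_cases h1 : i = 1
    · subst h1
      simp only [complexIncl, HomologicalComplex.mkHomFromDouble_f₁]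
      infer_instance
    · exact ⟨0, (HomologicalComplex.isZero_double_X (connMap1 n X) (by simp) i h0 h1).eq_of_src _ _,
        (HomologicalComplex.isZero_double_X (connMap n X) (by simp) i h0 h1).eq_of_src _ _⟩
  exact
    { exact := (ShortComplex.exact_iff_epi _ hg).2 inferInstance
      mono_f := inferInstance
      epi_g := ⟨fun _ _ _ => hX₃.eq_of_src _ _⟩ }

lemma triangleOfSESδ_expSequence : DerivedCategory.triangleOfSESδ (expSequence_shortExact n X) =
    DerivedCategory.Q.map (-((HomologicalComplex.single (Sh X) (ComplexShape.up ℤ) 0).map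
      (dlogMap n X) ≫ toTwoTermShift (connMap1 n X))) ≫
      ((DerivedCategory.Q (C := Sh X)).commShiftIso (1 : ℤ)).hom.app (twoTerm (connMap1 n X)) := by
  let r₀ : (twoTerm (connMap n X)).X 0 ⟶ (twoTerm (connMap1 n X)).X 0 :=
    (HomologicalComplex.doubleXIso₀ (connMap n X) _).hom ≫ retr n X ≫
      (HomologicalComplex.doubleXIso₀ (connMap1 n X) _).inv
  let r₁ : (twoTerm (connMap n X)).X 1 ⟶ (twoTerm (connMap1 n X)).X 1 :=
    (HomologicalComplex.doubleXIso₁ (connMap n X) _ (by simp)).hom ≫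
      (HomologicalComplex.doubleXIso₁ (connMap1 n X) _ (by simp)).inv
  -- The default value `0` is harmless, since both complexes vanish outside degrees `0` and `1`.
  let ρ : ∀ p, (twoTerm (connMap n X)).X p ⟶ (twoTerm (connMap1 n X)).X p :=
    Function.update (Function.update (fun _ => 0) 0 r₀) 1 r₁
  have hρ0 : ρ 0 = r₀ := by simp [ρ]
  have hρ1 : ρ 1 = r₁ := by simp [ρ]
  refine triangleOfSESδ_eq_of_retraction (expSequence_shortExact n X) ρ (fun p => ?_) _ fun p => ?_
  · by_cases h0 : p = 0
    · subst h0
      rw [hρ0]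
      simp [expSequence, complexIncl, r₀, reassoc_of% (incl_retr n X)]
    by_cases h1 : p = 1
    · subst h1
      rw [hρ1]
      simp [expSequence, complexIncl, r₁]
    exact (HomologicalComplex.isZero_double_X (connMap1 n X) (by simp) p h0 h1).eq_of_src _ _
  · by_cases h0 : p = 0
    · subst h0
      have e : (complexExp n X).f 0 =
          (HomologicalComplex.doubleXIso₀ (connMap n X) _).hom ≫ expMap n X ≫
            (HomologicalComplex.singleObjXSelf (ComplexShape.up ℤ) 0 (OOx n X)).inv := by
        simp [complexExp]
      have t : (toTwoTermShift (connMap1 n X)).f 0 =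
          (HomologicalComplex.singleObjXSelf (ComplexShape.up ℤ) 0 (Ω n X)).hom ≫
            (HomologicalComplex.doubleXIso₁ (connMap1 n X) _ (by simp)).inv ≫
              ((twoTerm (connMap1 n X)).shiftFunctorObjXIso 1 0 1 (by simp)).inv :=
        HomologicalComplex.mkHomFromSingle_f _ _
      change (complexExp n X).f 0 ≫ (-((HomologicalComplex.single (Sh X) (ComplexShape.up ℤ) 0).map
        (dlogMap n X) ≫ toTwoTermShift (connMap1 n X))).f 0 =
        ((twoTerm (connMap n X)).d 0 1 ≫ ρ 1 - ρ 0 ≫ (twoTerm (connMap1 n X)).d 0 1) ≫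
          ((twoTerm (connMap1 n X)).shiftFunctorObjXIso 1 0 1 rfl).inv
      rw [HomologicalComplex.neg_f_apply, HomologicalComplex.comp_f, t, e,
        HomologicalComplex.single_map_f_self, hρ0, hρ1, HomologicalComplex.double_d _ _ (by simp),
        HomologicalComplex.double_d _ _ (by simp)]
      simp only [r₀, r₁, Category.assoc, Iso.inv_hom_id_assoc, Preadditive.comp_neg]
      -- The difference `connMap - retr ≫ connMap1` becomes `-expMap ≫ dlogMap`, which produces the
      -- minus sign.
      rw [reassoc_of% (retr_connMap1 n X)]
      simp only [Preadditive.comp_add, Preadditive.add_comp, Preadditive.sub_comp, Category.assoc]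
      abel
    by_cases h1 : p = 1
    · subst h1
      have e : (complexExp n X).f 1 = 0 := by simp [complexExp]
      change (complexExp n X).f 1 ≫ (-((HomologicalComplex.single (Sh X) (ComplexShape.up ℤ) 0).map
        (dlogMap n X) ≫ toTwoTermShift (connMap1 n X))).f 1 =
        ((twoTerm (connMap n X)).d 1 2 ≫ ρ 2 - ρ 1 ≫ (twoTerm (connMap1 n X)).d 1 2) ≫
          ((twoTerm (connMap1 n X)).shiftFunctorObjXIso 1 1 2 rfl).inv
      rw [e, HomologicalComplex.double_d_eq_zero₀ _ _ _ _ (by simp),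
        HomologicalComplex.double_d_eq_zero₀ _ _ _ _ (by simp), Limits.zero_comp,
        Limits.zero_comp, Limits.comp_zero, sub_zero, Limits.zero_comp]
    exact (HomologicalComplex.isZero_double_X (connMap n X) (by simp) p h0 h1).eq_of_src _ _

lemma sectionHom_naturality {X : Type u} [TopologicalSpace X] {F G : Sh X} (φ : F ⟶ G)
    (s : H0 F) : sectionHom G (H0.map φ s) = sectionHom F s ≫ φ := by
  refine (sectionHom G).symm.injective ?_
  rw [AddEquiv.symm_apply_apply]
  obtain ⟨g, rfl⟩ := (sectionHom F).symm.surjective s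
  rw [AddEquiv.apply_symm_apply]
  exact (congrArg (AddCommGrpCat.uliftZMultiplesAddEquiv _)
    ((constantSheafAdj (Opens.grothendieckTopology X) AddCommGrpCat.{u}
      (Limits.isTerminalTop : Limits.IsTerminal (⊤ : Opens X))).homEquiv_naturality_right g φ)).symm

lemma boundary_eq : boundary (expSequence_shortExact n X) =
    (-H0.toHyperH1 (connMap1 n X)).comp (H0.map (dlogMap n X)) := by
  ext s
  change DerivedCategory.Q.map ((HomologicalComplex.single (Sh X) (ComplexShape.up ℤ) 0).map
      (sectionHom _ s)) ≫ DerivedCategory.triangleOfSESδ (expSequence_shortExact n X) =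
    -(DerivedCategory.Q.map ((HomologicalComplex.single (Sh X) (ComplexShape.up ℤ) 0).map
      (sectionHom _ (H0.map (dlogMap n X) s))) ≫ DerivedCategory.Q.map
        (toTwoTermShift (connMap1 n X)) ≫
      ((DerivedCategory.Q (C := Sh X)).commShiftIso (1 : ℤ)).hom.app (twoTerm (connMap1 n X)))
  rw [triangleOfSESδ_expSequence, sectionHom_naturality]
  simp only [Functor.map_comp, Functor.map_neg, Category.assoc, Preadditive.neg_comp]
  exact Preadditive.comp_neg _ _

end Boundary

/-! ### The global lift of `ε(a)` to `𝒪 ⊗ 𝒪` -/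

/-- Changing the logarithms `u`, `v` by multiples of the period `c` does not change the tensor
`a ⊗ u + b ⊗ v - c⁻¹ (a u + b v) ⊗ c`. -/
lemma entropy_tensor_eq {R : Type*} [CommRing R] (a b u v : R) {c d : R} (hc : d * c = 1)
    (k l : ℤ) :
    a ⊗ₜ[ℤ] u + b ⊗ₜ[ℤ] v - (d * (a * u + b * v)) ⊗ₜ[ℤ] c =
      a ⊗ₜ[ℤ] (u + k • c) + b ⊗ₜ[ℤ] (v + l • c) -
        (d * (a * (u + k • c) + b * (v + l • c))) ⊗ₜ[ℤ] c := by
  -- As `d c = 1`, the corrected coefficient changes by the integral combination `k a + l b`, whose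
  -- tensor with `c` is exactly `a ⊗ k c + b ⊗ l c`.
  have h : d * (a * (u + k • c) + b * (v + l • c)) =
      d * (a * u + b * v) + (k • a + l • b) := by
    simp only [zsmul_eq_mul]
    linear_combination (k * a + l * b) * hc
  rw [h, TensorProduct.tmul_add, TensorProduct.tmul_add, TensorProduct.add_tmul,
    TensorProduct.add_tmul, TensorProduct.smul_tmul, TensorProduct.smul_tmul]
  abel

section EntropySection

variable {n : ℕ} {X : Type u} [TopologicalSpace X] [ChartedSpace (Model n) X]

lemma IsLogPair.res {a : Hol n X ⊤} {U V : Opens X} {u v : Hol n X U} (h : IsLogPair a u v)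
    (i : V ≤ U) : IsLogPair a (Hol.res i u) (Hol.res i v) :=
  ⟨congrArg (Hol.res i) h.1, congrArg (Hol.res i) h.2⟩

lemma map_entropySection (a : Hol n X ⊤) {U V : Opens X} (u v : Hol n X U) (i : V ⟶ U) :
    (OO n X).obj.map i.op (entropySection a u v) =
      entropySection a (Hol.res (leOfHom i) u) (Hol.res (leOfHom i) v) := by
  refine (map_toSection (F := tensorPresheaf (O n X) (O n X)) i _).trans (congrArg _ ?_)
  let e : Hol n X U ⊗[ℤ] Hol n X U →+ Hol n X V ⊗[ℤ] Hol n X V :=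
    ((tensorPresheaf (O n X) (O n X)).map i.op).hom
  refine (map_sub e _ _).trans ?_
  rw [map_add]
  rfl

lemma Hol.exists_eq_add_zsmul {U : Opens X} (hU : IsPreconnected (U : Set X))
    {u u' : Hol n X U} (h : u.exp = u'.exp) :
    ∃ k : ℤ, u' = u + k • Hol.const U (2 * Real.pi * Complex.I) := by
  have h1 : (u' - u).exp = 1 := DFunLike.ext _ _ fun x => by
    have hx : Complex.exp (u x) = Complex.exp (u' x) := DFunLike.congr_fun h x
    change Complex.exp (u' x - u x) = 1
    rw [Complex.exp_sub, hx, div_self (Complex.exp_ne_zero _)]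
  obtain ⟨z, hz⟩ := Hol.exists_eq_const hU h1
  obtain ⟨k, hk⟩ := AddSubgroup.mem_zmultiples_iff.1 z.2
  refine ⟨k, ?_⟩
  have hc : Hol.const (n := n) U (z : ℂ) = k • Hol.const U (2 * Real.pi * Complex.I) := by
    rw [← hk]
    exact (AddMonoidHom.mk' (Hol.const (n := n) U) (Hol.const_add _)).map_zsmul _ _
  rw [← hc, ← hz, add_sub_cancel]

lemma entropySection_eq_of_isPreconnected {a : Hol n X ⊤} {U : Opens X}
    (hU : IsPreconnected (U : Set X)) {u v u' v' : Hol n X U} (h : IsLogPair a u v)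
    (h' : IsLogPair a u' v') : entropySection a u v = entropySection a u' v' := by
  obtain ⟨k, rfl⟩ := Hol.exists_eq_add_zsmul hU (h.1.trans h'.1.symm)
  obtain ⟨l, rfl⟩ := Hol.exists_eq_add_zsmul hU (h.2.trans h'.2.symm)
  exact congrArg (toSection (F := tensorPresheaf (O n X) (O n X)) U)
    (entropy_tensor_eq _ _ u v (Hol.const_inv_mul_const U) k l)

/-- The integers by which two pairs of branches differ may vary between components of `U`, so the
comparison is made on connected neighbourhoods. -/
lemma entropySection_eq {a : Hol n X ⊤} {U : Opens X} {u v u' v' : Hol n X U}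
    (h : IsLogPair a u v) (h' : IsLogPair a u' v') :
    entropySection a u v = entropySection a u' v' := by
  refine Sh.eq_of_locally_eq (OO n X) _ _ fun x hx => ?_
  obtain ⟨V, i, hxV, hV⟩ := exists_isPreconnected_nhd n U hx
  refine ⟨V, i, hxV, ?_⟩
  rw [map_entropySection, map_entropySection]
  exact entropySection_eq_of_isPreconnected hV (h.res _) (h'.res _)

lemma exists_isLogPair {a : Hol n X ⊤} (h₀ : IsUnit a) (h₁ : IsUnit (1 - a)) (x : X) :
    ∃ (U : Opens X) (u v : Hol n X U), x ∈ U ∧ IsLogPair a u v := by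
  obtain ⟨V, i, hxV, u, hu⟩ := Hol.exists_local_log h₀.unit (x := x) trivial
  obtain ⟨W, j, hxW, v, hv⟩ := Hol.exists_local_log h₁.unit (x := x) trivial
  exact ⟨V ⊓ W, Hol.res inf_le_left u, Hol.res inf_le_right v, ⟨hxV, hxW⟩,
    congrArg (Hol.res (inf_le_left : V ⊓ W ≤ V)) hu,
    congrArg (Hol.res (inf_le_right : V ⊓ W ≤ W)) hv⟩

lemma exists_unique_entropySection {a : Hol n X ⊤} (h₀ : IsUnit a) (h₁ : IsUnit (1 - a)) :
    ∃ s : H0 (OO n X),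
      (∀ (U : Opens X) (u v : Hol n X U), IsLogPair a u v →
        (OO n X).obj.map (homOfLE le_top).op s = entropySection a u v) ∧
      ∀ s' : H0 (OO n X),
        (∀ (U : Opens X) (u v : Hol n X U), IsLogPair a u v →
          (OO n X).obj.map (homOfLE le_top).op s' = entropySection a u v) → s' = s := by
  -- Gluing over all pairs of branches at once avoids choosing a cover and gives the formula for
  -- every pair.
  let ι : Type u := Σ U : Opens X, {p : Hol n X U × Hol n X U // IsLogPair a p.1 p.2}
  obtain ⟨s, hs, -⟩ := TopCat.Sheaf.existsUnique_gluing' (X := TopCat.of X) (OO n X)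
    (fun i : ι => i.1) ⊤ (fun i => homOfLE le_top)
    (fun x _ => by
      obtain ⟨U, u, v, hx, h⟩ := exists_isLogPair h₀ h₁ x
      exact Opens.mem_iSup.2 ⟨⟨U, ⟨(u, v), h⟩⟩, hx⟩)
    (fun i => entropySection a i.2.1.1 i.2.1.2)
    (fun i j => by
      refine (map_entropySection a _ _ _).trans (Eq.trans ?_ (map_entropySection a _ _ _).symm)
      exact entropySection_eq (i.2.2.res _) (j.2.2.res _))
  refine ⟨s, fun U u v h => hs ⟨U, ⟨(u, v), h⟩⟩, fun s' hs' => ?_⟩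
  refine Sh.eq_of_locally_eq (OO n X) _ _ fun x _ => ?_
  obtain ⟨U, u, v, hx, h⟩ := exists_isLogPair h₀ h₁ x
  exact ⟨U, le_top, hx, (hs' U u v h).trans (hs ⟨U, ⟨(u, v), h⟩⟩).symm⟩

lemma Hol.expUnit_two_pi_I (U : Opens X) :
    (Hol.const (n := n) U (2 * Real.pi * Complex.I)).expUnit = 1 :=
  exp_Z1 n X U twoPiI

/-- The branches exponentiate to `a` and `1 - a`, and the correction term becomes a tensor with `exp
(2πi) = 1`, which is zero. -/
lemma expMap_entropySection {a : Hol n X ⊤} (h₀ : IsUnit a) (h₁ : IsUnit (1 - a)) {U : Opens X}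
    {u v : Hol n X U} (h : IsLogPair a u v) :
    (expMap n X).hom.app (op U) (entropySection a u v) =
      (OOx n X).obj.map (homOfLE (le_top : U ≤ ⊤)).op (cathelineau h₀ h₁) := by
  refine (presheafToSheaf_map_toSection (expPre n X) _).trans
    (Eq.trans (congrArg _ ?_) (map_toSection (F := tensorPresheaf (O n X) (Ounits n X)) _ _).symm)
  let e : Hol n X U ⊗[ℤ] Hol n X U →+ Hol n X U ⊗[ℤ] Additive (Hol n X U)ˣ :=
    ((expPre n X).app (op U)).hom
  refine (map_sub e _ _).trans ?_
  rw [map_add]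
  have hu : u.expUnit = Units.map (Hol.res (le_top : U ≤ ⊤)).toMonoidHom h₀.unit := Units.ext h.1
  have hv : v.expUnit = Units.map (Hol.res (le_top : U ≤ ⊤)).toMonoidHom h₁.unit := Units.ext h.2
  change (Hol.res le_top a : Hol n X U) ⊗ₜ[ℤ] Additive.ofMul u.expUnit +
      (Hol.res le_top (1 - a) : Hol n X U) ⊗ₜ[ℤ] Additive.ofMul v.expUnit -
      _ ⊗ₜ[ℤ] Additive.ofMul (Hol.const (n := n) U (2 * Real.pi * Complex.I)).expUnit = _
  rw [Hol.expUnit_two_pi_I, ofMul_one, TensorProduct.tmul_zero, sub_zero, hu, hv]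
  let r : Hol n X ⊤ ⊗[ℤ] Additive (Hol n X ⊤)ˣ →+ Hol n X U ⊗[ℤ] Additive (Hol n X U)ˣ :=
    ((tensorPresheaf (O n X) (Ounits n X)).map (homOfLE (le_top : U ≤ ⊤)).op).hom
  exact (map_add r (a ⊗ₜ[ℤ] Additive.ofMul h₀.unit)
    ((1 - a) ⊗ₜ[ℤ] Additive.ofMul h₁.unit)).symm

end EntropySection

end AdditiveRegulator

end

open AdditiveRegulator
theorem mainTheorem9 (n : ℕ) (X : Type*) [TopologicalSpace X] [ChartedSpace (Model n) X]
    [IsManifold 𝓘(ℂ, Model n) ω X] :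
    (∀ (U : Opens X) (a : Hol n X U) (f : (Hol n X U)ˣ),
      (dlogMap n X).hom.app (op U)
          (toSection (F := tensorPresheaf (O n X) (Ounits n X)) U (a ⊗ₜ[ℤ] Additive.ofMul f)) =
        Forms.smul a (Hol.dlog f)) ∧
    (∃ h : (expSequence n X).ShortExact,
      boundary h = (-H0.toHyperH1 (connMap1 n X)).comp (H0.map (dlogMap n X))) ∧
    (∀ (a : Hol n X ⊤) (h₀ : IsUnit a) (h₁ : IsUnit (1 - a)),
      ∃ s : H0 (OO n X),
        (∀ (U : Opens X) (u v : Hol n X U), IsLogPair a u v →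
          (OO n X).obj.map (homOfLE le_top).op s = entropySection a u v) ∧
        (∀ s' : H0 (OO n X),
          (∀ (U : Opens X) (u v : Hol n X U), IsLogPair a u v →
            (OO n X).obj.map (homOfLE le_top).op s' = entropySection a u v) → s' = s) ∧
        H0.map (expMap n X) s = cathelineau h₀ h₁) ∧
    (∀ (a : Hol n X ⊤) (U : Opens X) (u v : Hol n X U), IsLogPair a u v →
      (entropy a u v).d = Forms.smul (u - v) (Hol.res le_top a : Hol n X U).d) ∧
    (∀ z : ℂ, z ∈ Complex.slitPlane → 1 - z ∈ Complex.slitPlane →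
      IntervalIntegrable (fun r : ℝ => Complex.log (r * z / (1 - r * z)) * z)
        MeasureTheory.volume 0 1 ∧
      entropyIntegral z = z * Complex.log z + (1 - z) * Complex.log (1 - z)) := by
  refine ⟨dlogMap_toSection n X, ⟨expSequence_shortExact n X, boundary_eq n X⟩,
    fun a h₀ h₁ => ?_, fun a U u v h => d_entropy a u v h,
    fun z h₀ h₁ => ⟨intervalIntegrable_log_integrand h₀ h₁, entropyIntegral_eq h₀ h₁⟩⟩
  obtain ⟨s, hs, huniq⟩ := exists_unique_entropySection h₀ h₁
  refine ⟨s, hs, huniq, ?_⟩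
  -- The equality in `𝒪 ⊗ 𝒪ˣ` is local, so it is checked on domains of branches of both logarithms.
  refine Sh.eq_of_locally_eq (OOx n X) _ _ fun x _ => ?_
  obtain ⟨U, u, v, hx, h⟩ := exists_isLogPair h₀ h₁ x
  refine ⟨U, le_top, hx, ?_⟩
  refine (ConcreteCategory.congr_hom ((expMap n X).hom.naturality
    (homOfLE (le_top : U ≤ ⊤)).op) s).symm.trans ?_
  exact (congrArg ((expMap n X).hom.app (op U)) (hs U u v h)).trans
    (expMap_entropySection h₀ h₁ h)
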